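/- Let $n_x,n_u,N\in\mathbb N$ and let $\theta_i=(A_i,B_i)$, $i=0,\dots,N$, with $A_i\in\mathbb R^{n_x\times n_x}$, $B_i\in\mathbb R^{n_x\times n_u}$, be a finite list of candidate linear systems; write $\theta_*=(A_*,B_*)=\theta_0$ for the true one and $\Delta A_i=A_*-A_i$, $\Delta B_i=B_*-B_i$. Let $\Sigma_w\in\mathbb R^{n_x\times n_x}$ and $\Sigma_u\in\mathbb R^{n_u\times n_u}$ be symmetric positive definite, and let $\Sigma_w^{1/2},\Sigma_u^{1/2},\Sigma_w^{-1/2}$ be square matrices with $\Sigma_w^{1/2}(\Sigma_w^{1/2})^\top=\Sigma_w$, $\Sigma_u^{1/2}(\Sigma_u^{1/2})^\top=\Sigma_u$, $(\Sigma_w^{-1/2})^\top\Sigma_w^{-1/2}=\Sigma_w^{-1}$. Let the data be generated by $$x_{t+1}=A_*x_t+B_*u_t+w_t,\qquad t=0,1,2,\dots,$$ from a deterministic initial state $x_0\in\mathbb R^{n_x}$, where $w_t\sim\mathcal N(0,\Sigma_w)$ and $u_t\sim\mathcal N(0,\Sigma_u)$, $t\ge 0$, are all mutually independent. For $T\ge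 1$ let $$\hat L(\theta_i)=\frac1T\sum_{t=1}^{T}(x_{t+1}-A_ix_t-B_iu_t)^\top\Sigma_w^{-1}(x_{t+1}-A_ix_t-B_iu_t),$$ and let the maximum likelihood estimator $\hat\theta_T$ be any (arbitrarily selected) element of $\arg\min_{\theta\in\{\theta_0,\dots,\theta_N\}}\hat L(\theta)$. For $t\in\mathbb N$ define $$\Delta\Lambda_i^u(t)=\Delta A_i\sum_{s=0}^{t}A_*^sB_*\Sigma_u^{1/2},\qquad \Delta\Lambda_i^w(t)=\Delta A_i\sum_{s=0}^{t}A_*^s\Sigma_w^{1/2},$$ $$\Sigma_{x_t}=\sum_{\tau=0}^{t}\Big(A_*^\tau B_*\Sigma_u(A_*^\tau B_*)^\top+A_*^\tau\Sigma_w(A_*^\tau)^\top\Big),$$ $$\Sigma^i_{z_t}=I+\Sigma_w^{-1/2}\Big(\Delta B_i\Sigma_u\Delta B_i^\top+\Delta A_i\Sigma_{x_t}\Delta A_i^\top\Big)(\Sigma_w^{-1/2})^\top.$$ Let $\delta\in(0,1)$ and suppose that there is an integer $k\in[1,T]$ such that $$\lfloor T/k\rfloor\ \ge\ \tfrac{320}{3}\log\!\big(2n_xN/\delta\big)$$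 and such that, for every $i\in\{1,\dots,N\}$, with $m=\lfloor k/2\rfloor$, $$\sqrt{n_x}+n_x\ \le\ \frac{9k\lfloor T/k\rfloor}{3200\,T}\;E_i$$ holds for at least one of the two quantities $$E_i=\operatorname{Tr}\big(\Sigma^i_{z_m}\big)\qquad\text{or}\qquad E_i=\big\|\Sigma_w^{-1/2}\Delta\Lambda_i^w(m)\big\|_F^2+n_x+\big\|\Sigma_w^{-1/2}\Delta B_i\Sigma_u^{1/2}\big\|_F^2+\big\|\Sigma_w^{-1/2}\Delta\Lambda_i^u(m)\big\|_F^2 .$$ Then $\mathbb P[\hat\theta_T=\theta_*]\ge 1-\delta$. No stability assumption on $A_*$ is made. -/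

import Mathlib

open MeasureTheory ProbabilityTheory Matrix

/-- A linear time-invariant system `x⁺ = A x + B u`, given by the pair `θ = (A, B)`. -/
@[ext]
structure LTISystem (nx nu : ℕ) where
  A : Matrix (Fin nx) (Fin nx) ℝ
  B : Matrix (Fin nx) (Fin nu) ℝ

/-- The squared Frobenius norm of a real matrix. -/
def frobSq {m n : ℕ} (M : Matrix (Fin m) (Fin n) ℝ) : ℝ :=
  ∑ i, ∑ j, (M i j) ^ 2

/-- `x` is the trajectory of `x_{t+1} = A x_t + B u_t + w_t` started at the point `x₀`. -/
def IsTrajectory {Ω : Type*} {nx nu : ℕ} (θ : LTISystem nx nu)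
    (x₀ : EuclideanSpace ℝ (Fin nx)) (x : ℕ → Ω → EuclideanSpace ℝ (Fin nx))
    (u : ℕ → Ω → EuclideanSpace ℝ (Fin nu)) (w : ℕ → Ω → EuclideanSpace ℝ (Fin nx)) : Prop :=
  (∀ ω, x 0 ω = x₀) ∧
    ∀ t ω, x (t + 1) ω =
      Matrix.toEuclideanLin θ.A (x t ω) + Matrix.toEuclideanLin θ.B (u t ω) + w t ω

/-- The process noise and the control input are i.i.d. centred Gaussian with covariances `Σw`
and `Σu`: the pairs `(w_t, u_t)` are independent over time, the two components of each pair are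
independent (so all the `w_t`, `u_t` are mutually independent), and `w_t ∼ N(0, Σw)`,
`u_t ∼ N(0, Σu)`. -/
structure IsGaussianExcitation {Ω : Type*} [MeasurableSpace Ω] {nx nu : ℕ} (μ : Measure Ω)
    (Sigw : Matrix (Fin nx) (Fin nx) ℝ) (Sigu : Matrix (Fin nu) (Fin nu) ℝ)
    (u : ℕ → Ω → EuclideanSpace ℝ (Fin nu)) (w : ℕ → Ω → EuclideanSpace ℝ (Fin nx)) : Prop where
  indep_time : iIndepFun (fun t ω => (w t ω, u t ω)) μ
  indep_noise_input : ∀ t, IndepFun (w t) (u t) μ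
  law_noise : ∀ t, HasLaw (w t) (multivariateGaussian 0 Sigw) μ
  law_input : ∀ t, HasLaw (u t) (multivariateGaussian 0 Sigu) μ

/-- The cost `‖x⁺ - A x - B u‖²` in the norm weighted by `Σw⁻¹`. -/
noncomputable def cost {nx nu : ℕ} (Sigw : Matrix (Fin nx) (Fin nx) ℝ) (θ : LTISystem nx nu)
    (xnext x : EuclideanSpace ℝ (Fin nx)) (u : EuclideanSpace ℝ (Fin nu)) : ℝ :=
  let r : Fin nx → ℝ := xnext.ofLp - θ.A *ᵥ x.ofLp - θ.B *ᵥ u.ofLp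
  r ⬝ᵥ (Sigw⁻¹ *ᵥ r)

/-- The empirical risk `(1/T) ∑_{t=1}^T ℓ_θ(x_t, u_t)` of one realization of the data. -/
noncomputable def empRisk {nx nu : ℕ} (Sigw : Matrix (Fin nx) (Fin nx) ℝ) (T : ℕ)
    (x : ℕ → EuclideanSpace ℝ (Fin nx)) (u : ℕ → EuclideanSpace ℝ (Fin nu))
    (θ : LTISystem nx nu) : ℝ :=
  (1 / (T : ℝ)) * ∑ t ∈ Finset.Icc 1 T, cost Sigw θ (x (t + 1)) (x t) (u t)

/-- `θhat` is a maximum likelihood estimate over the set `S` of candidate systems: it belongs to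
the argmin of the empirical risk over `S`. -/
def IsMLE {nx nu : ℕ} (Sigw : Matrix (Fin nx) (Fin nx) ℝ) (T : ℕ)
    (x : ℕ → EuclideanSpace ℝ (Fin nx)) (u : ℕ → EuclideanSpace ℝ (Fin nu))
    (S : Set (LTISystem nx nu)) (θhat : LTISystem nx nu) : Prop :=
  θhat ∈ S ∧ IsMinOn (empRisk Sigw T x u) S θhat

/-- `Σ_{x_t} = ∑_{τ=0}^t (A^τ B Σu (A^τ B)ᵀ + A^τ Σw (A^τ)ᵀ)`. -/
def stateGram {nx nu : ℕ} (Sigw : Matrix (Fin nx) (Fin nx) ℝ)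
    (Sigu : Matrix (Fin nu) (Fin nu) ℝ) (θ : LTISystem nx nu) (t : ℕ) :
    Matrix (Fin nx) (Fin nx) ℝ :=
  ∑ τ ∈ Finset.range (t + 1),
    ((θ.A ^ τ * θ.B) * Sigu * (θ.A ^ τ * θ.B)ᵀ + θ.A ^ τ * Sigw * (θ.A ^ τ)ᵀ)

/-- `Σ^i_{z_t} = I + W (ΔB Σu ΔBᵀ + ΔA Σ_{x_t} ΔAᵀ) Wᵀ`, where `W` plays the role of
`Σw^{-1/2}`, `ΔA = A_* - A_i` and `ΔB = B_* - B_i`; here `θs = (A_*, B_*)`, `θ = (A_i, B_i)`. -/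
def zCov {nx nu : ℕ} (Sigw : Matrix (Fin nx) (Fin nx) ℝ) (Sigu : Matrix (Fin nu) (Fin nu) ℝ)
    (W : Matrix (Fin nx) (Fin nx) ℝ) (θs θ : LTISystem nx nu) (t : ℕ) :
    Matrix (Fin nx) (Fin nx) ℝ :=
  1 + W * ((θs.B - θ.B) * Sigu * (θs.B - θ.B)ᵀ +
    (θs.A - θ.A) * stateGram Sigw Sigu θs t * (θs.A - θ.A)ᵀ) * Wᵀ

/-- `ΔΛ_i^u(t) = ΔA ∑_{s=0}^t A_*^s B_* Σu^{1/2}`, where `Ru` plays the role of `Σu^{1/2}`. -/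
def dLambdaU {nx nu : ℕ} (Ru : Matrix (Fin nu) (Fin nu) ℝ) (θs θ : LTISystem nx nu) (t : ℕ) :
    Matrix (Fin nx) (Fin nu) ℝ :=
  (θs.A - θ.A) * ∑ s ∈ Finset.range (t + 1), θs.A ^ s * θs.B * Ru

/-- `ΔΛ_i^w(t) = ΔA ∑_{s=0}^t A_*^s Σw^{1/2}`, where `Rw` plays the role of `Σw^{1/2}`. -/
def dLambdaW {nx nu : ℕ} (Rw : Matrix (Fin nx) (Fin nx) ℝ) (θs θ : LTISystem nx nu) (t : ℕ) :
    Matrix (Fin nx) (Fin nx) ℝ :=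
  (θs.A - θ.A) * ∑ s ∈ Finset.range (t + 1), θs.A ^ s * Rw

/-- The excitation written through Frobenius norms:
`‖Σw^{-1/2} ΔΛ_i^w(t)‖² + n_x + ‖Σw^{-1/2} ΔB_i Σu^{1/2}‖² + ‖Σw^{-1/2} ΔΛ_i^u(t)‖²`. -/
def frobExcitation {nx nu : ℕ} (W Rw : Matrix (Fin nx) (Fin nx) ℝ)
    (Ru : Matrix (Fin nu) (Fin nu) ℝ) (θs θ : LTISystem nx nu) (t : ℕ) : ℝ :=
  frobSq (W * dLambdaW Rw θs θ t) + (nx : ℝ) + frobSq (W * (θs.B - θ.B) * Ru) +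
    frobSq (W * dLambdaU Ru θs θ t)

/-! Fix a wrong candidate and put z_t = W(ΔA x_t + ΔB u_t). Since WᵀW = Σw⁻¹, its total cost exceeds
that of the true system by Σ (|z_t|² + 2 z_t·W w_t) (`cost_sub_cost`), so it can win only if the
noise term outweighs the energy Σ |z_t|². Two exponential moments control this event. Given the past
and u_t, the vector W w_t is standard normal, so M = exp Σ (-½ z_t·W w_t - ⅛ |z_t|²) has mean at
most 1 (`IsGaussianExcitation.lintegral_exp_tilted_le_one`), while M ≥ exp(⅛ Σ |z_t|²) on the error
event. By AM-GM and Markov the error probability is at most c once E exp(-⅛ Σ |z_t|²) ≤ c²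
(`measure_le_of_lintegral_exp_le`).

Only a lower bound on the energy is thus needed, which is why stability plays no role. Given the
past, a coordinate Y of z_t is Gaussian with some mean and with at least the variance v injected by
the recent steps, so E exp(-αY²) ≤ (1 + 2αv)^(-1/2). Jensen's inequality
(`lintegral_exp_neg_sum_sq_le`) combines all coordinates over k steps without any independence
between them. Time is cut into J blocks of length 2k: the first half of each refreshes the
randomness, the second half is counted. The signal-to-noise condition makes each block contribute a
factor at most e⁻², the burn-in condition gives e^(-2J) ≤ (δ/N)², and a union bound over the N wrong
candidates finishes. -/

/-! ### Gaussian Laplace transforms and Jensen's inequality. -/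

/-- The Laplace transform of the square of a shifted centred real Gaussian. -/
lemma lintegral_exp_neg_sq_gaussianReal (v : NNReal) {α : ℝ} (hα : 0 ≤ α) (y : ℝ) :
    ∫⁻ ξ, ENNReal.ofReal (Real.exp (-(α * (y + ξ) ^ 2))) ∂(gaussianReal 0 v) =
      ENNReal.ofReal ((Real.sqrt (1 + 2 * α * v))⁻¹ *
        Real.exp (-(α / (1 + 2 * α * v) * y ^ 2))) := by
  by_cases hv : v = 0
  · subst hv
    rw [gaussianReal_zero_var, lintegral_dirac' _ (by fun_prop)]
    simp
  have hv0 : 0 < (v : ℝ) := by positivity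
  have hd : 0 < 1 + 2 * α * v := by positivity
  set d : ℝ := 1 + 2 * α * v with hdd
  obtain ⟨v', hv'⟩ : ∃ v' : NNReal, (v' : ℝ) = v / d := ⟨⟨v / d, by positivity⟩, rfl⟩
  have hv'0 : v' ≠ 0 := by
    intro h
    rw [h] at hv'
    have : 0 < (v : ℝ) / d := by positivity
    simp [← hv'] at this
  rw [gaussianReal_of_var_ne_zero _ hv,
    lintegral_withDensity_eq_lintegral_mul _ (measurable_gaussianPDF _ _) (by fun_prop)]
  -- Completing the square: the product is a constant times the Gaussian density of variance v/d and
  -- mean -2αvy/d, which integrates to 1.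
  have key : ∀ ξ : ℝ, (gaussianPDF 0 v * fun ξ => ENNReal.ofReal (Real.exp (-(α * (y + ξ) ^ 2)))) ξ
      = ENNReal.ofReal ((Real.sqrt d)⁻¹ * Real.exp (-(α / d * y ^ 2))) *
        gaussianPDF (-(2 * α * v * y / d)) v' ξ := by
    intro ξ
    simp only [Pi.mul_apply, gaussianPDF]
    rw [← ENNReal.ofReal_mul (gaussianPDFReal_nonneg _ _ _), ← ENNReal.ofReal_mul (by positivity)]
    congr 1
    simp only [gaussianPDFReal]
    rw [hv']
    have h1 : (Real.sqrt (2 * Real.pi * (v / d)))⁻¹ = Real.sqrt d * (Real.sqrt (2 * Real.pi * v))⁻¹ := by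
      rw [← mul_div_assoc, Real.sqrt_div' _ hd.le, inv_div, div_eq_mul_inv]
    rw [h1]
    have h2 : Real.sqrt d ≠ 0 := by positivity
    rw [mul_assoc, ← Real.exp_add]
    have h3 : -(ξ - 0) ^ 2 / (2 * (v : ℝ)) + -(α * (y + ξ) ^ 2) =
        -(α / d * y ^ 2) + -(ξ - -(2 * α * v * y / d)) ^ 2 / (2 * (v / d)) := by
      field_simp
      rw [hdd]
      ring
    rw [h3, Real.exp_add]
    field_simp
  simp_rw [key]
  rw [lintegral_const_mul _ (measurable_gaussianPDF _ _), lintegral_gaussianPDF_eq_one _ hv'0, mul_one]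

section Multivariate
variable {n : ℕ} {S : Matrix (Fin n) (Fin n) ℝ}

/-- Reduces every vector integral below to a one-dimensional one. -/
lemma map_dotProduct_multivariateGaussian (hS : S.PosSemidef) (a : Fin n → ℝ) :
    (multivariateGaussian 0 S).map (fun w => a ⬝ᵥ w.ofLp) =
      gaussianReal 0 (a ⬝ᵥ S *ᵥ a).toNNReal := by
  have hL : (fun w : EuclideanSpace ℝ (Fin n) => a ⬝ᵥ w.ofLp) =
      (innerSL ℝ (WithLp.toLp 2 a) : EuclideanSpace ℝ (Fin n) →L[ℝ] ℝ) := by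
    ext w
    simp [PiLp.inner_apply, dotProduct, mul_comm]
  rw [hL, IsGaussian.map_eq_gaussianReal, ContinuousLinearMap.integral_comp_id_comm]
  · congr 1
    · simp
    · have h := covarianceBilin_multivariateGaussian (μ := 0) hS (WithLp.toLp 2 a) (WithLp.toLp 2 a)
      rw [covarianceBilin_self IsGaussian.memLp_two_id] at h
      exact congrArg Real.toNNReal h
  · exact IsGaussian.integrable_id

lemma measurable_dotProduct_ofLp (a : Fin n → ℝ) :
    Measurable (fun w : EuclideanSpace ℝ (Fin n) => a ⬝ᵥ w.ofLp) := by
  unfold dotProduct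
  fun_prop

lemma lintegral_exp_neg_sq_multivariateGaussian (hS : S.PosSemidef) (a : Fin n → ℝ)
    {α : ℝ} (hα : 0 ≤ α) (y : ℝ) :
    ∫⁻ w, ENNReal.ofReal (Real.exp (-(α * (y + a ⬝ᵥ w.ofLp) ^ 2))) ∂(multivariateGaussian 0 S) =
      ENNReal.ofReal ((Real.sqrt (1 + 2 * α * (a ⬝ᵥ S *ᵥ a)))⁻¹ *
        Real.exp (-(α / (1 + 2 * α * (a ⬝ᵥ S *ᵥ a)) * y ^ 2))) := by
  have hq : 0 ≤ a ⬝ᵥ S *ᵥ a := by simpa using hS.dotProduct_mulVec_nonneg a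
  have h := lintegral_exp_neg_sq_gaussianReal (a ⬝ᵥ S *ᵥ a).toNNReal hα y
  rw [← map_dotProduct_multivariateGaussian hS a,
    lintegral_map (by fun_prop) (measurable_dotProduct_ofLp a), Real.coe_toNNReal _ hq] at h
  exact h

lemma lintegral_exp_dotProduct_multivariateGaussian (hS : S.PosSemidef) (a : Fin n → ℝ) :
    ∫⁻ w, ENNReal.ofReal (Real.exp (a ⬝ᵥ w.ofLp)) ∂(multivariateGaussian 0 S) =
      ENNReal.ofReal (Real.exp ((a ⬝ᵥ S *ᵥ a) / 2)) := by
  have hq : 0 ≤ a ⬝ᵥ S *ᵥ a := by simpa using hS.dotProduct_mulVec_nonneg a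
  have h : ∫⁻ ξ, ENNReal.ofReal (Real.exp ξ) ∂(gaussianReal 0 (a ⬝ᵥ S *ᵥ a).toNNReal) =
      ENNReal.ofReal (Real.exp ((a ⬝ᵥ S *ᵥ a) / 2)) := by
    have hm := congrFun (mgf_id_gaussianReal (μ := 0) (v := (a ⬝ᵥ S *ᵥ a).toNNReal)) 1
    have hi := integrable_exp_mul_gaussianReal (μ := 0) (v := (a ⬝ᵥ S *ᵥ a).toNNReal) 1
    rw [← ofReal_integral_eq_lintegral_ofReal (by simpa using hi)
      (Filter.Eventually.of_forall fun _ => (Real.exp_pos _).le)]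
    simp only [mgf, id_eq, one_mul] at hm
    rw [hm, Real.coe_toNNReal _ hq]
    simp
  rw [← map_dotProduct_multivariateGaussian hS a,
    lintegral_map (by fun_prop) (measurable_dotProduct_ofLp a)] at h
  exact h

end Multivariate

/-- The Laplace transform of the square of a shifted sum of linear forms in two independent
centred Gaussian vectors. -/
lemma lintegral_exp_neg_sq_multivariateGaussian_pair {n m : ℕ} {S : Matrix (Fin n) (Fin n) ℝ}
    {R : Matrix (Fin m) (Fin m) ℝ} (hS : S.PosSemidef) (hR : R.PosSemidef)
    (a : Fin n → ℝ) (c : Fin m → ℝ) {α : ℝ} (hα : 0 ≤ α) (y : ℝ) :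
    ∫⁻ u, ∫⁻ w, ENNReal.ofReal (Real.exp (-(α * (y + c ⬝ᵥ u.ofLp + a ⬝ᵥ w.ofLp) ^ 2)))
        ∂(multivariateGaussian 0 S) ∂(multivariateGaussian 0 R) =
      ENNReal.ofReal ((Real.sqrt (1 + 2 * α * (a ⬝ᵥ S *ᵥ a + c ⬝ᵥ R *ᵥ c)))⁻¹ *
        Real.exp (-(α / (1 + 2 * α * (a ⬝ᵥ S *ᵥ a + c ⬝ᵥ R *ᵥ c)) * y ^ 2))) := by
  have hq : 0 ≤ a ⬝ᵥ S *ᵥ a := by simpa using hS.dotProduct_mulVec_nonneg a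
  have hr : 0 ≤ c ⬝ᵥ R *ᵥ c := by simpa using hR.dotProduct_mulVec_nonneg c
  simp_rw [lintegral_exp_neg_sq_multivariateGaussian hS a hα]
  set q := a ⬝ᵥ S *ᵥ a
  set r := c ⬝ᵥ R *ᵥ c with hrr
  have h1 : 0 < 1 + 2 * α * q := by positivity
  simp_rw [ENNReal.ofReal_mul (inv_nonneg.2 (Real.sqrt_nonneg (1 + 2 * α * q)))]
  rw [lintegral_const_mul' _ _ ENNReal.ofReal_ne_top,
    lintegral_exp_neg_sq_multivariateGaussian hR c (by positivity), ← hrr,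
    ← ENNReal.ofReal_mul (by positivity), ← mul_assoc, ← mul_inv, ← Real.sqrt_mul h1.le,
    ENNReal.ofReal_mul (by positivity), ENNReal.ofReal_mul (by positivity)]
  -- Integrating out a variance q turns α into α / (1 + 2αq). This identity says that successive
  -- integrations add the variances.
  have h2 : (1 + 2 * α * q) * (1 + 2 * (α / (1 + 2 * α * q)) * r) = 1 + 2 * α * (q + r) := by
    field_simp
    ring
  have h3 : α / (1 + 2 * α * q) / (1 + 2 * (α / (1 + 2 * α * q)) * r) =
      α / (1 + 2 * α * (q + r)) := by
    rw [div_div, h2]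
  rw [h2, h3]

/-- Jensen's inequality transfers a bound on the Laplace transforms of single squares to a sum of
squares, with the variances adding up. -/
lemma lintegral_exp_neg_sum_sq_le {Ω ι : Type*} [MeasurableSpace Ω] {μ : Measure Ω}
    (s : Finset ι) (h : Ω → ENNReal) (Y : ι → Ω → ℝ) (v : ι → ℝ)
    (hmeas : ∀ j ∈ s, ∀ α : ℝ,
      AEMeasurable (fun ω => h ω * ENNReal.ofReal (Real.exp (-(α * (Y j ω) ^ 2)))) μ)
    (hv : ∀ j ∈ s, 0 ≤ v j) (hV : 0 < ∑ j ∈ s, v j)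
    (hY : ∀ j ∈ s, ∀ α : ℝ, 0 ≤ α →
      ∫⁻ ω, h ω * ENNReal.ofReal (Real.exp (-(α * (Y j ω) ^ 2))) ∂μ ≤
        ENNReal.ofReal (Real.sqrt (1 + 2 * α * v j))⁻¹ * ∫⁻ ω, h ω ∂μ)
    {β : ℝ} (hβ : 0 ≤ β) :
    ∫⁻ ω, h ω * ENNReal.ofReal (Real.exp (-(β * ∑ j ∈ s, (Y j ω) ^ 2))) ∂μ ≤
      ENNReal.ofReal (Real.sqrt (1 + 2 * β * ∑ j ∈ s, v j))⁻¹ * ∫⁻ ω, h ω ∂μ := by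
  set V := ∑ j ∈ s, v j with hVd
  have hp : ∀ j ∈ s, 0 ≤ v j / V := fun j hj => div_nonneg (hv j hj) hV.le
  have hsum : ∑ j ∈ s, v j / V = 1 := by rw [← Finset.sum_div, ← hVd, div_self hV.ne']
  have hpt : ∀ ω, Real.exp (-(β * ∑ j ∈ s, (Y j ω) ^ 2)) ≤
      ∑ j ∈ s, v j / V * Real.exp (-(β / (v j / V) * (Y j ω) ^ 2)) := by
    intro ω
    have hJ := convexOn_exp.map_sum_le (t := s) (w := fun j => v j / V)
      (p := fun j => -(β / (v j / V) * (Y j ω) ^ 2)) hp hsum (fun _ _ => Set.mem_univ _)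
    simp only [smul_eq_mul] at hJ
    refine le_trans (Real.exp_le_exp.2 ?_) hJ
    rw [Finset.mul_sum, ← Finset.sum_neg_distrib]
    refine Finset.sum_le_sum fun j hj => ?_
    -- A term of zero variance has zero weight and is dropped; this only weakens the bound, as its
    -- exponent is nonpositive.
    rcases (hp j hj).eq_or_lt with h0 | h0
    · rw [← h0]
      simp only [zero_mul]
      have : 0 ≤ β * (Y j ω) ^ 2 := by positivity
      linarith
    · rw [mul_neg, ← mul_assoc, mul_div_cancel₀ _ h0.ne']
  calc ∫⁻ ω, h ω * ENNReal.ofReal (Real.exp (-(β * ∑ j ∈ s, (Y j ω) ^ 2))) ∂μ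
      ≤ ∫⁻ ω, ∑ j ∈ s, ENNReal.ofReal (v j / V) *
          (h ω * ENNReal.ofReal (Real.exp (-(β / (v j / V) * (Y j ω) ^ 2)))) ∂μ := by
        refine lintegral_mono fun ω => ?_
        refine (mul_le_mul_right (ENNReal.ofReal_le_ofReal (hpt ω)) (h ω)).trans ?_
        rw [ENNReal.ofReal_sum_of_nonneg
          (fun j hj => mul_nonneg (hp j hj) (Real.exp_pos _).le), Finset.mul_sum]
        refine Finset.sum_le_sum fun j hj => le_of_eq ?_
        rw [ENNReal.ofReal_mul (hp j hj)]
        ring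
    _ = ∑ j ∈ s, ENNReal.ofReal (v j / V) * ∫⁻ ω,
          (h ω * ENNReal.ofReal (Real.exp (-(β / (v j / V) * (Y j ω) ^ 2)))) ∂μ := by
        rw [lintegral_finsetSum' _ fun j hj => (hmeas j hj _).const_mul _]
        exact Finset.sum_congr rfl fun j hj => lintegral_const_mul' _ _ ENNReal.ofReal_ne_top
    _ ≤ ∑ j ∈ s, ENNReal.ofReal (v j / V) *
          (ENNReal.ofReal (Real.sqrt (1 + 2 * β * V))⁻¹ * ∫⁻ ω, h ω ∂μ) := by
        refine Finset.sum_le_sum fun j hj => ?_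
        rcases (hp j hj).eq_or_lt with h0 | h0
        · simp [← h0]
        -- The weight p_j = v_j / V cancels the variance: (β / p_j) v_j = β V, so every term has the
        -- same bound.
        · refine mul_le_mul_right ((hY j hj _ (div_nonneg hβ h0.le)).trans (le_of_eq ?_)) _
          congr 5
          have hvj : v j ≠ 0 := fun hz => by simp [hz] at h0
          field_simp
    _ = _ := by
        rw [← Finset.sum_mul, ← ENNReal.ofReal_sum_of_nonneg hp, hsum, ENNReal.ofReal_one, one_mul]

/-! ### The filtration and adaptedness of the state. -/

/-- The information carried by the noise and the input strictly before time `t`. -/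
@[reducible] def pastAlgebra {Ω E F : Type*} [MeasurableSpace E] [MeasurableSpace F]
    (w : ℕ → Ω → E) (u : ℕ → Ω → F) (t : ℕ) : MeasurableSpace Ω :=
  ⨆ s ∈ Set.Iio t, MeasurableSpace.comap (fun ω => (w s ω, u s ω)) inferInstance

section Past
variable {Ω E F : Type*} [MeasurableSpace E] [MeasurableSpace F]
  {w : ℕ → Ω → E} {u : ℕ → Ω → F}

lemma pastAlgebra_le [m : MeasurableSpace Ω] (hw : ∀ t, Measurable (w t))
    (hu : ∀ t, Measurable (u t)) (t : ℕ) : pastAlgebra w u t ≤ m :=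
  iSup₂_le fun s _ => ((hw s).prodMk (hu s)).comap_le

lemma pastAlgebra_mono {s t : ℕ} (h : s ≤ t) : pastAlgebra w u s ≤ pastAlgebra w u t :=
  biSup_mono fun _ hr => lt_of_lt_of_le hr h

lemma measurable_pair_pastAlgebra {s t : ℕ} (h : s < t) :
    Measurable[pastAlgebra w u t] (fun ω => (w s ω, u s ω)) :=
  (comap_measurable _).mono (le_biSup (fun s => MeasurableSpace.comap
    (fun ω => (w s ω, u s ω)) inferInstance) (show s ∈ Set.Iio t from h)) le_rfl

end Past

section Trajectory
variable {Ω : Type*} {nx nu : ℕ} {u : ℕ → Ω → EuclideanSpace ℝ (Fin nu)}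
  {w : ℕ → Ω → EuclideanSpace ℝ (Fin nx)} {θ : LTISystem nx nu} {x₀ : EuclideanSpace ℝ (Fin nx)}
  {x : ℕ → Ω → EuclideanSpace ℝ (Fin nx)}

lemma IsTrajectory.succ_ofLp (hx : IsTrajectory θ x₀ x u w) (t : ℕ) (ω : Ω) :
    (x (t + 1) ω).ofLp = θ.A *ᵥ (x t ω).ofLp + θ.B *ᵥ (u t ω).ofLp + (w t ω).ofLp := by
  rw [hx.2 t ω]
  rfl

/-- The state at time t involves only pairs (w_s, u_s) with s < t, which makes it independent of
(w_t, u_t). -/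
lemma IsTrajectory.measurable_pastAlgebra (hx : IsTrajectory θ x₀ x u w) (t : ℕ) :
    Measurable[pastAlgebra w u t] (x t) := by
  induction t with
  | zero =>
    have : x 0 = fun _ => x₀ := funext hx.1
    rw [this]
    exact measurable_const
  | succ t ih =>
    have h1 : Measurable[pastAlgebra w u (t + 1)] (x t) :=
      ih.mono (pastAlgebra_mono t.le_succ) le_rfl
    have h2 := measurable_pair_pastAlgebra (w := w) (u := u) t.lt_succ_self
    have h3 : x (t + 1) = (fun q : EuclideanSpace ℝ (Fin nx) × EuclideanSpace ℝ (Fin nx) ×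
        EuclideanSpace ℝ (Fin nu) => Matrix.toEuclideanLin θ.A q.1 +
          Matrix.toEuclideanLin θ.B q.2.2 + q.2.1) ∘ fun ω => (x t ω, (w t ω, u t ω)) :=
      funext (hx.2 t)
    rw [h3]
    refine Measurable.comp ?_ (h1.prodMk h2)
    have hA : Measurable (Matrix.toEuclideanLin θ.A) :=
      (LinearMap.continuous_of_finiteDimensional _).measurable
    have hB : Measurable (Matrix.toEuclideanLin θ.B) :=
      (LinearMap.continuous_of_finiteDimensional _).measurable
    fun_prop

end Trajectory

/-! ### Conditional Laplace transforms of linear functionals of the state. -/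

section Noise
variable {Ω : Type*} [MeasurableSpace Ω] {μ : Measure Ω} [IsProbabilityMeasure μ]
  {nx nu : ℕ} {Sigw : Matrix (Fin nx) (Fin nx) ℝ} {Sigu : Matrix (Fin nu) (Fin nu) ℝ}
  {u : ℕ → Ω → EuclideanSpace ℝ (Fin nu)} {w : ℕ → Ω → EuclideanSpace ℝ (Fin nx)}

/-- Integrating out the noise and the input at time `t`, which are independent of the past. -/
lemma IsGaussianExcitation.lintegral_past (hdata : IsGaussianExcitation μ Sigw Sigu u w)
    (hw : ∀ t, Measurable (w t)) (hu : ∀ t, Measurable (u t)) (t : ℕ)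
    {P : Type*} [MeasurableSpace P] {p : Ω → P} (hp : Measurable[pastAlgebra w u t] p)
    (f : P → EuclideanSpace ℝ (Fin nx) → EuclideanSpace ℝ (Fin nu) → ENNReal)
    (hf : Measurable fun q : P × EuclideanSpace ℝ (Fin nx) × EuclideanSpace ℝ (Fin nu) =>
      f q.1 q.2.1 q.2.2) :
    ∫⁻ ω, f (p ω) (w t ω) (u t ω) ∂μ =
      ∫⁻ ω, ∫⁻ b, ∫⁻ a, f (p ω) a b ∂(multivariateGaussian 0 Sigw)
        ∂(multivariateGaussian 0 Sigu) ∂μ := by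
  have hp' : Measurable p := hp.mono (pastAlgebra_le hw hu t) le_rfl
  have hX : Measurable fun ω => (w t ω, u t ω) := (hw t).prodMk (hu t)
  -- The past and the present are generated by disjoint sets of indices.
  have hind : IndepFun p (fun ω => (w t ω, u t ω)) μ := by
    have h := indep_iSup_of_disjoint (m := fun s => MeasurableSpace.comap
      (fun ω => (w s ω, u s ω)) inferInstance) (fun s => ((hw s).prodMk (hu s)).comap_le)
      ((iIndepFun_iff_iIndep _ _ _).1 hdata.indep_time) (S := Set.Iio t) (T := {t}) (by simp)
    rw [IndepFun_iff_Indep]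
    refine indep_of_indep_of_le_right (indep_of_indep_of_le_left h hp.comap_le) ?_
    simp
  have hlaw : μ.map (fun ω => (w t ω, u t ω)) =
      (multivariateGaussian 0 Sigw).prod (multivariateGaussian 0 Sigu) := by
    rw [(indepFun_iff_map_prod_eq_prod_map_map (hw t).aemeasurable (hu t).aemeasurable).1
      (hdata.indep_noise_input t), (hdata.law_noise t).map_eq, (hdata.law_input t).map_eq]
  have hjoint := (indepFun_iff_map_prod_eq_prod_map_map hp'.aemeasurable hX.aemeasurable).1 hind
  have hprob : IsProbabilityMeasure (μ.map p) := Measure.isProbabilityMeasure_map hp'.aemeasurable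
  calc ∫⁻ ω, f (p ω) (w t ω) (u t ω) ∂μ
      = ∫⁻ q, f q.1 q.2.1 q.2.2 ∂(μ.map fun ω => (p ω, (w t ω, u t ω))) :=
        (lintegral_map hf (hp'.prodMk hX)).symm
    _ = ∫⁻ y, ∫⁻ q, f y q.1 q.2 ∂((multivariateGaussian 0 Sigw).prod
          (multivariateGaussian 0 Sigu)) ∂(μ.map p) := by
        rw [hjoint, hlaw, lintegral_prod _ hf.aemeasurable]
    _ = ∫⁻ ω, ∫⁻ q, f (p ω) q.1 q.2 ∂((multivariateGaussian 0 Sigw).prod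
          (multivariateGaussian 0 Sigu)) ∂μ :=
        lintegral_map hf.lintegral_prod_right' hp'
    _ = _ := by
        refine lintegral_congr fun ω => ?_
        exact lintegral_prod_symm _ (hf.comp measurable_prodMk_left).aemeasurable

/-- The variance of `a ⬝ᵥ x_τ` caused by the noise and the input of the last `τ` steps. -/
def stateVar (Sigw : Matrix (Fin nx) (Fin nx) ℝ) (Sigu : Matrix (Fin nu) (Fin nu) ℝ)
    (θ : LTISystem nx nu) (τ : ℕ) (a : Fin nx → ℝ) : ℝ :=
  ∑ s ∈ Finset.range τ, ((a ᵥ* θ.A ^ s) ⬝ᵥ Sigw *ᵥ (a ᵥ* θ.A ^ s) +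
    (a ᵥ* θ.A ^ s ᵥ* θ.B) ⬝ᵥ Sigu *ᵥ (a ᵥ* θ.A ^ s ᵥ* θ.B))

lemma dotProduct_mulVec_self_nonneg {n : ℕ} {S : Matrix (Fin n) (Fin n) ℝ} (hS : S.PosSemidef)
    (a : Fin n → ℝ) : 0 ≤ a ⬝ᵥ S *ᵥ a := by
  simpa using hS.dotProduct_mulVec_nonneg a

lemma stateVar_nonneg (hw : Sigw.PosSemidef) (hu : Sigu.PosSemidef) (θ : LTISystem nx nu) (τ : ℕ)
    (a : Fin nx → ℝ) : 0 ≤ stateVar Sigw Sigu θ τ a :=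
  Finset.sum_nonneg fun _ _ => add_nonneg (dotProduct_mulVec_self_nonneg hw _)
    (dotProduct_mulVec_self_nonneg hu _)

lemma stateVar_mono (hw : Sigw.PosSemidef) (hu : Sigu.PosSemidef) (θ : LTISystem nx nu)
    {σ τ : ℕ} (h : σ ≤ τ) (a : Fin nx → ℝ) :
    stateVar Sigw Sigu θ σ a ≤ stateVar Sigw Sigu θ τ a :=
  Finset.sum_le_sum_of_subset_of_nonneg (Finset.range_mono h) fun _ _ _ =>
    add_nonneg (dotProduct_mulVec_self_nonneg hw _) (dotProduct_mulVec_self_nonneg hu _)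

/-- Peels off the most recent noise and input; the remaining steps are seen through the functional
`a ᵥ* θ.A`. This is the recursion of the induction below. -/
lemma stateVar_succ (θ : LTISystem nx nu) (τ : ℕ) (a : Fin nx → ℝ) :
    stateVar Sigw Sigu θ (τ + 1) a = stateVar Sigw Sigu θ τ (a ᵥ* θ.A) +
      (a ⬝ᵥ Sigw *ᵥ a + (a ᵥ* θ.B) ⬝ᵥ Sigu *ᵥ (a ᵥ* θ.B)) := by
  simp [stateVar, Finset.sum_range_succ', pow_succ', vecMul_vecMul]

variable {θ : LTISystem nx nu} {x₀ : EuclideanSpace ℝ (Fin nx)}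
  {x : ℕ → Ω → EuclideanSpace ℝ (Fin nx)}

/-- The conditional Laplace transform of the square of a linear functional of the state. -/
lemma IsGaussianExcitation.lintegral_exp_neg_sq_state_le
    (hdata : IsGaussianExcitation μ Sigw Sigu u w)
    (hSw : Sigw.PosSemidef) (hSu : Sigu.PosSemidef)
    (hw : ∀ t, Measurable (w t)) (hu : ∀ t, Measurable (u t))
    (hx : IsTrajectory θ x₀ x u w) (t : ℕ)
    {h : Ω → ENNReal} (hh : Measurable[pastAlgebra w u t] h) (τ : ℕ) (a : Fin nx → ℝ)
    {α : ℝ} (hα : 0 ≤ α) :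
    ∫⁻ ω, h ω * ENNReal.ofReal (Real.exp (-(α * (a ⬝ᵥ (x (t + τ) ω).ofLp) ^ 2))) ∂μ ≤
      ENNReal.ofReal (Real.sqrt (1 + 2 * α * stateVar Sigw Sigu θ τ a))⁻¹ * ∫⁻ ω, h ω ∂μ := by
  induction τ generalizing a α with
  | zero =>
    -- The state at time t is part of the past and may be arbitrary, so the exponential is bounded
    -- by 1. The weight `h` plays the role of conditioning on that past.
    simp only [stateVar, Finset.range_zero, Finset.sum_empty, mul_zero, add_zero, Real.sqrt_one,
      inv_one, ENNReal.ofReal_one, one_mul]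
    refine lintegral_mono fun ω => mul_le_of_le_one_right zero_le ?_
    rw [ENNReal.ofReal_le_one, Real.exp_le_one_iff]
    have : 0 ≤ α * (a ⬝ᵥ (x t ω).ofLp) ^ 2 := by positivity
    linarith
  | succ τ ih =>
    have hh' : Measurable[pastAlgebra w u (t + τ)] h :=
      hh.mono (pastAlgebra_mono (t.le_add_right τ)) le_rfl
    have hy : Measurable[pastAlgebra w u (t + τ)]
        (fun ω => (a ᵥ* θ.A) ⬝ᵥ (x (t + τ) ω).ofLp) :=
      (measurable_dotProduct_ofLp _).comp (hx.measurable_pastAlgebra _)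
    have hma := measurable_dotProduct_ofLp (a := a)
    have hmb := measurable_dotProduct_ofLp (a := a ᵥ* θ.B)
    have hpast := hdata.lintegral_past hw hu (t + τ) (hh'.prodMk hy)
      (fun p b c => p.1 * ENNReal.ofReal
        (Real.exp (-(α * (p.2 + (a ᵥ* θ.B) ⬝ᵥ c.ofLp + a ⬝ᵥ b.ofLp) ^ 2)))) (by fun_prop)
    have hstep : ∀ ω, a ⬝ᵥ (x (t + (τ + 1)) ω).ofLp = (a ᵥ* θ.A) ⬝ᵥ (x (t + τ) ω).ofLp +
        (a ᵥ* θ.B) ⬝ᵥ (u (t + τ) ω).ofLp + a ⬝ᵥ (w (t + τ) ω).ofLp := fun ω => by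
      rw [← add_assoc, hx.succ_ofLp, dotProduct_add, dotProduct_add, dotProduct_mulVec,
        dotProduct_mulVec]
    simp_rw [hstep]
    rw [hpast]
    set q := a ⬝ᵥ Sigw *ᵥ a + (a ᵥ* θ.B) ⬝ᵥ Sigu *ᵥ (a ᵥ* θ.B) with hq
    have hq0 : 0 ≤ q := add_nonneg (dotProduct_mulVec_self_nonneg hSw _)
      (dotProduct_mulVec_self_nonneg hSu _)
    have hV := stateVar_nonneg hSw hSu θ τ (a ᵥ* θ.A)
    have hd : 0 < 1 + 2 * α * q := by positivity
    have hinner : ∀ ω, ∫⁻ c, ∫⁻ b, h ω * ENNReal.ofReal (Real.exp (-(α *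
          ((a ᵥ* θ.A) ⬝ᵥ (x (t + τ) ω).ofLp + (a ᵥ* θ.B) ⬝ᵥ c.ofLp + a ⬝ᵥ b.ofLp) ^ 2)))
          ∂(multivariateGaussian 0 Sigw) ∂(multivariateGaussian 0 Sigu) =
        ENNReal.ofReal (Real.sqrt (1 + 2 * α * q))⁻¹ * (h ω * ENNReal.ofReal (Real.exp
          (-(α / (1 + 2 * α * q) * ((a ᵥ* θ.A) ⬝ᵥ (x (t + τ) ω).ofLp) ^ 2)))) := by
      intro ω
      have h1 : ∀ c : EuclideanSpace ℝ (Fin nu), Measurable fun b : EuclideanSpace ℝ (Fin nx) =>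
          ENNReal.ofReal (Real.exp (-(α * ((a ᵥ* θ.A) ⬝ᵥ (x (t + τ) ω).ofLp +
            (a ᵥ* θ.B) ⬝ᵥ c.ofLp + a ⬝ᵥ b.ofLp) ^ 2))) := fun c => by fun_prop
      simp_rw [lintegral_const_mul _ (h1 _)]
      rw [lintegral_const_mul, lintegral_exp_neg_sq_multivariateGaussian_pair hSw hSu _ _ hα,
        ENNReal.ofReal_mul (by positivity)]
      · ring
      · exact Measurable.lintegral_prod_left' (f := fun q : EuclideanSpace ℝ (Fin nx) ×
          EuclideanSpace ℝ (Fin nu) => ENNReal.ofReal (Real.exp (-(α *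
          ((a ᵥ* θ.A) ⬝ᵥ (x (t + τ) ω).ofLp + (a ᵥ* θ.B) ⬝ᵥ q.2.ofLp + a ⬝ᵥ q.1.ofLp) ^ 2))))
          (by fun_prop)
    rw [lintegral_congr hinner, lintegral_const_mul' _ _ ENNReal.ofReal_ne_top]
    -- The induction hypothesis applies with the functional `a ᵥ* θ.A` and the parameter α / (1 +
    -- 2αq).
    refine (mul_le_mul_right (ih (a ᵥ* θ.A) (div_nonneg hα hd.le)) _).trans (le_of_eq ?_)
    rw [← mul_assoc, ← ENNReal.ofReal_mul (by positivity), ← mul_inv, ← Real.sqrt_mul hd.le,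
      stateVar_succ, ← hq]
    congr 4
    field_simp
    ring

/-- The conditional Laplace transform of the square of a linear functional of state and input. -/
lemma IsGaussianExcitation.lintegral_exp_neg_sq_le
    (hdata : IsGaussianExcitation μ Sigw Sigu u w)
    (hSw : Sigw.PosSemidef) (hSu : Sigu.PosSemidef)
    (hw : ∀ t, Measurable (w t)) (hu : ∀ t, Measurable (u t))
    (hx : IsTrajectory θ x₀ x u w) (t : ℕ)
    {h : Ω → ENNReal} (hh : Measurable[pastAlgebra w u t] h) (τ : ℕ) (a : Fin nx → ℝ)
    (c : Fin nu → ℝ) {α : ℝ} (hα : 0 ≤ α) :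
    ∫⁻ ω, h ω * ENNReal.ofReal (Real.exp (-(α * (a ⬝ᵥ (x (t + τ) ω).ofLp +
        c ⬝ᵥ (u (t + τ) ω).ofLp) ^ 2))) ∂μ ≤
      ENNReal.ofReal (Real.sqrt (1 + 2 * α * (stateVar Sigw Sigu θ τ a + c ⬝ᵥ Sigu *ᵥ c)))⁻¹ *
        ∫⁻ ω, h ω ∂μ := by
  have hh' : Measurable[pastAlgebra w u (t + τ)] h :=
    hh.mono (pastAlgebra_mono (t.le_add_right τ)) le_rfl
  have hy : Measurable[pastAlgebra w u (t + τ)] (fun ω => a ⬝ᵥ (x (t + τ) ω).ofLp) :=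
    (measurable_dotProduct_ofLp _).comp (hx.measurable_pastAlgebra _)
  have hmb := measurable_dotProduct_ofLp (a := c)
  rw [hdata.lintegral_past hw hu (t + τ) (hh'.prodMk hy) (fun p _ b => p.1 * ENNReal.ofReal
    (Real.exp (-(α * (p.2 + c ⬝ᵥ b.ofLp) ^ 2)))) (by fun_prop)]
  set q := c ⬝ᵥ Sigu *ᵥ c with hq
  have hq0 : 0 ≤ q := dotProduct_mulVec_self_nonneg hSu _
  have hV := stateVar_nonneg hSw hSu θ τ a
  have hd : 0 < 1 + 2 * α * q := by positivity
  have hinner : ∀ ω, ∫⁻ b, ∫⁻ _, h ω * ENNReal.ofReal (Real.exp (-(α *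
        (a ⬝ᵥ (x (t + τ) ω).ofLp + c ⬝ᵥ b.ofLp) ^ 2)))
        ∂(multivariateGaussian 0 Sigw) ∂(multivariateGaussian 0 Sigu) =
      ENNReal.ofReal (Real.sqrt (1 + 2 * α * q))⁻¹ * (h ω * ENNReal.ofReal (Real.exp
        (-(α / (1 + 2 * α * q) * (a ⬝ᵥ (x (t + τ) ω).ofLp) ^ 2)))) := by
    intro ω
    simp only [lintegral_const, measure_univ, mul_one]
    rw [lintegral_const_mul _ (by fun_prop),
      lintegral_exp_neg_sq_multivariateGaussian hSu c hα, ENNReal.ofReal_mul (by positivity)]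
    ring
  rw [lintegral_congr hinner, lintegral_const_mul' _ _ ENNReal.ofReal_ne_top]
  refine (mul_le_mul_right (hdata.lintegral_exp_neg_sq_state_le hSw hSu hw hu hx t hh τ a
    (div_nonneg hα hd.le)) _).trans (le_of_eq ?_)
  rw [← mul_assoc, ← ENNReal.ofReal_mul (by positivity), ← mul_inv, ← Real.sqrt_mul hd.le]
  congr 4
  field_simp
  ring

end Noise

/-! ### The prediction gap z_t, its likelihood martingale and its energy. -/

/-- The normalized difference of the one-step predictions of two systems. -/
def predictionGap {nx nu : ℕ} (W : Matrix (Fin nx) (Fin nx) ℝ) (θs θ : LTISystem nx nu)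
    (x : EuclideanSpace ℝ (Fin nx)) (u : EuclideanSpace ℝ (Fin nu)) : Fin nx → ℝ :=
  W *ᵥ ((θs.A - θ.A) *ᵥ x.ofLp + (θs.B - θ.B) *ᵥ u.ofLp)

section Gap
variable {nx nu : ℕ} {W : Matrix (Fin nx) (Fin nx) ℝ} {θs θ : LTISystem nx nu}

lemma predictionGap_apply (x : EuclideanSpace ℝ (Fin nx)) (u : EuclideanSpace ℝ (Fin nu))
    (r : Fin nx) : predictionGap W θs θ x u r =
      (W * (θs.A - θ.A)) r ⬝ᵥ x.ofLp + (W * (θs.B - θ.B)) r ⬝ᵥ u.ofLp := by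
  rw [predictionGap, mulVec_add, mulVec_mulVec, mulVec_mulVec]
  rfl

lemma measurable_predictionGap : Measurable fun q : EuclideanSpace ℝ (Fin nx) ×
    EuclideanSpace ℝ (Fin nu) => predictionGap W θs θ q.1 q.2 := by
  refine measurable_pi_iff.2 fun r => ?_
  simp_rw [predictionGap_apply]
  have h1 := measurable_dotProduct_ofLp (a := (W * (θs.A - θ.A)) r)
  have h2 := measurable_dotProduct_ofLp (a := (W * (θs.B - θ.B)) r)
  fun_prop

lemma measurable_predictionGap_sq : Measurable fun q : EuclideanSpace ℝ (Fin nx) ×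
    EuclideanSpace ℝ (Fin nu) => predictionGap W θs θ q.1 q.2 ⬝ᵥ predictionGap W θs θ q.1 q.2 := by
  have h := fun r => (measurable_pi_iff.1 (measurable_predictionGap (W := W) (θs := θs) (θ := θ))) r
  unfold dotProduct
  fun_prop

lemma measurable_predictionGap_noise : Measurable fun q : EuclideanSpace ℝ (Fin nx) ×
    EuclideanSpace ℝ (Fin nx) × EuclideanSpace ℝ (Fin nu) =>
      predictionGap W θs θ q.1 q.2.2 ⬝ᵥ W *ᵥ q.2.1.ofLp := by
  have h := fun r => ((measurable_pi_iff.1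
    (measurable_predictionGap (W := W) (θs := θs) (θ := θ))) r).comp
    (measurable_fst.prodMk measurable_snd.snd : Measurable fun q : EuclideanSpace ℝ (Fin nx) ×
    EuclideanSpace ℝ (Fin nx) × EuclideanSpace ℝ (Fin nu) => (q.1, q.2.2))
  simp only [Function.comp_def] at h
  unfold mulVec dotProduct
  fun_prop

end Gap

/-- The variance that the last `t` steps and the current input contribute to the prediction gap. -/
def gapVar {nx nu : ℕ} (Sigw : Matrix (Fin nx) (Fin nx) ℝ) (Sigu : Matrix (Fin nu) (Fin nu) ℝ)
    (W : Matrix (Fin nx) (Fin nx) ℝ) (θs θ : LTISystem nx nu) (t : ℕ) : ℝ :=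
  ∑ r, (stateVar Sigw Sigu θs t ((W * (θs.A - θ.A)) r) +
    (W * (θs.B - θ.B)) r ⬝ᵥ Sigu *ᵥ (W * (θs.B - θ.B)) r)

section Noise
variable {Ω : Type*} [MeasurableSpace Ω] {μ : Measure Ω} [IsProbabilityMeasure μ]
  {nx nu : ℕ} {Sigw : Matrix (Fin nx) (Fin nx) ℝ} {Sigu : Matrix (Fin nu) (Fin nu) ℝ}
  {u : ℕ → Ω → EuclideanSpace ℝ (Fin nu)} {w : ℕ → Ω → EuclideanSpace ℝ (Fin nx)}
  {θs : LTISystem nx nu} {x₀ : EuclideanSpace ℝ (Fin nx)}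
  {x : ℕ → Ω → EuclideanSpace ℝ (Fin nx)}

/-- The log-likelihood ratios, tilted by one half and compensated, form an exponential
martingale. -/
lemma IsGaussianExcitation.lintegral_exp_tilted_le_one
    (hdata : IsGaussianExcitation μ Sigw Sigu u w) (hSw : Sigw.PosSemidef)
    (hw : ∀ t, Measurable (w t)) (hu : ∀ t, Measurable (u t))
    (hx : IsTrajectory θs x₀ x u w) {W : Matrix (Fin nx) (Fin nx) ℝ} (hW : W * Sigw * Wᵀ = 1)
    (θ : LTISystem nx nu) (T : ℕ) :
    ∫⁻ ω, ENNReal.ofReal (Real.exp (∑ t ∈ Finset.Icc 1 T,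
      (-(1 / 2) * (predictionGap W θs θ (x t ω) (u t ω) ⬝ᵥ W *ᵥ (w t ω).ofLp) -
        1 / 8 * (predictionGap W θs θ (x t ω) (u t ω) ⬝ᵥ
          predictionGap W θs θ (x t ω) (u t ω))))) ∂μ ≤ 1 := by
  have hg1 := measurable_predictionGap_noise (W := W) (θs := θs) (θ := θ)
  have hg2 := (measurable_predictionGap_sq (W := W) (θs := θs) (θ := θ)).comp
    (measurable_fst.prodMk measurable_snd.snd : Measurable fun q : EuclideanSpace ℝ (Fin nx) ×
    EuclideanSpace ℝ (Fin nx) × EuclideanSpace ℝ (Fin nu) => (q.1, q.2.2))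
  simp only [Function.comp_def] at hg2
  set L : EuclideanSpace ℝ (Fin nx) × EuclideanSpace ℝ (Fin nx) × EuclideanSpace ℝ (Fin nu) → ℝ :=
    fun q => -(1 / 2) * (predictionGap W θs θ q.1 q.2.2 ⬝ᵥ W *ᵥ q.2.1.ofLp) -
        1 / 8 * (predictionGap W θs θ q.1 q.2.2 ⬝ᵥ predictionGap W θs θ q.1 q.2.2) with hL
  have hLm : Measurable L := (hg1.const_mul _).sub (hg2.const_mul _)
  change ∫⁻ ω, ENNReal.ofReal (Real.exp (∑ t ∈ Finset.Icc 1 T, L (x t ω, w t ω, u t ω))) ∂μ ≤ 1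
  induction T with
  | zero => simp
  | succ T ih =>
    refine le_trans (le_of_eq ?_) ih
    simp_rw [Finset.sum_Icc_succ_top (Nat.le_add_left 1 T), Real.exp_add,
      ENNReal.ofReal_mul (Real.exp_pos _).le]
    have hS : Measurable[pastAlgebra w u (T + 1)] fun ω =>
        ∑ t ∈ Finset.Icc 1 T, L (x t ω, w t ω, u t ω) := by
      refine Finset.measurable_sum _ fun t ht => hLm.comp ?_
      have ht' : t < T + 1 := Nat.lt_succ_of_le (Finset.mem_Icc.1 ht).2
      exact ((hx.measurable_pastAlgebra t).mono (pastAlgebra_mono ht'.le) le_rfl).prodMk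
        (measurable_pair_pastAlgebra ht')
    rw [hdata.lintegral_past hw hu (T + 1) (hS.prodMk (hx.measurable_pastAlgebra (T + 1)))
      (fun p b c => ENNReal.ofReal (Real.exp p.1) * ENNReal.ofReal (Real.exp (L (p.2, b, c))))
      (by fun_prop)]
    refine lintegral_congr fun ω => ?_
    -- The noise alone suffices, for each fixed input: E exp(-½ z·W w) = exp(|z|²/8), which the
    -- compensator cancels.
    have hone : ∀ c, ∫⁻ b, ENNReal.ofReal (Real.exp (L (x (T + 1) ω, b, c)))
        ∂(multivariateGaussian 0 Sigw) = 1 := by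
      intro c
      set z := predictionGap W θs θ (x (T + 1) ω) c with hz
      have h1 : ∀ b : EuclideanSpace ℝ (Fin nx), ENNReal.ofReal (Real.exp (L (x (T + 1) ω, b, c))) =
          ENNReal.ofReal (Real.exp (-(1 / 8 * (z ⬝ᵥ z)))) *
            ENNReal.ofReal (Real.exp (((-(1 / 2) : ℝ) • (z ᵥ* W)) ⬝ᵥ b.ofLp)) := by
        intro b
        rw [← ENNReal.ofReal_mul (Real.exp_pos _).le, ← Real.exp_add, hL]
        simp only [← hz, smul_dotProduct, smul_eq_mul, dotProduct_mulVec]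
        congr 2
        ring
      simp_rw [h1]
      rw [lintegral_const_mul' _ _ ENNReal.ofReal_ne_top,
        lintegral_exp_dotProduct_multivariateGaussian hSw,
        ← ENNReal.ofReal_mul (Real.exp_pos _).le, ← Real.exp_add]
      have h2 : (z ᵥ* W) ⬝ᵥ Sigw *ᵥ (z ᵥ* W) = z ⬝ᵥ z := by
        rw [← mulVec_transpose, mulVec_mulVec, mulVec_transpose, ← dotProduct_mulVec, mulVec_mulVec,
          ← mul_assoc, hW, one_mulVec]
      rw [smul_dotProduct, mulVec_smul, dotProduct_smul, h2]
      simp only [smul_eq_mul]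
      rw [show -(1 / 8 * (z ⬝ᵥ z)) + -(1 / 2) * (-(1 / 2) * (z ⬝ᵥ z)) / 2 = 0 by ring]
      simp
    simp_rw [lintegral_const_mul' _ _ ENNReal.ofReal_ne_top, hone]
    simp

/-- Over `k` steps, after `k` steps of excitation, the prediction gap has a conditional Laplace
transform that is small as soon as its total variance is large. -/
lemma IsGaussianExcitation.lintegral_exp_neg_gap_block_le
    (hdata : IsGaussianExcitation μ Sigw Sigu u w)
    (hSw : Sigw.PosSemidef) (hSu : Sigu.PosSemidef)
    (hw : ∀ t, Measurable (w t)) (hu : ∀ t, Measurable (u t))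
    (hx : IsTrajectory θs x₀ x u w) (W : Matrix (Fin nx) (Fin nx) ℝ) (θ : LTISystem nx nu)
    {k l : ℕ} (hk : 0 < k) (hl : l ≤ k) (hG : 0 < gapVar Sigw Sigu W θs θ l) (t : ℕ)
    {h : Ω → ENNReal} (hh : Measurable[pastAlgebra w u t] h) {β : ℝ} (hβ : 0 ≤ β) :
    ∫⁻ ω, h ω * ENNReal.ofReal (Real.exp (-(β * ∑ τ ∈ Finset.range k,
        predictionGap W θs θ (x (t + (k + τ)) ω) (u (t + (k + τ)) ω) ⬝ᵥ
          predictionGap W θs θ (x (t + (k + τ)) ω) (u (t + (k + τ)) ω)))) ∂μ ≤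
      ENNReal.ofReal (Real.sqrt (1 + 2 * β * (k * gapVar Sigw Sigu W θs θ l)))⁻¹ *
        ∫⁻ ω, h ω ∂μ := by
  set s : Finset (ℕ × Fin nx) := Finset.range k ×ˢ Finset.univ with hs
  set v : ℕ × Fin nx → ℝ := fun j => stateVar Sigw Sigu θs (k + j.1) ((W * (θs.A - θ.A)) j.2) +
    (W * (θs.B - θ.B)) j.2 ⬝ᵥ Sigu *ᵥ (W * (θs.B - θ.B)) j.2 with hv
  -- Each of the k counted times lies at least k ≥ l steps after t, so it contributes at least
  -- `gapVar` at horizon l.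
  have hV : k * gapVar Sigw Sigu W θs θ l ≤ ∑ j ∈ s, v j := by
    have hτ : ∀ τ ∈ Finset.range k, gapVar Sigw Sigu W θs θ l ≤ ∑ r, v (τ, r) := fun τ _ =>
      Finset.sum_le_sum fun r _ => add_le_add_left
        (stateVar_mono hSw hSu θs (hl.trans (Nat.le_add_right k τ)) _) _
    have h := Finset.card_nsmul_le_sum _ _ _ hτ
    rwa [Finset.card_range, nsmul_eq_mul, ← Finset.sum_product] at h
  have hkG : 0 < k * gapVar Sigw Sigu W θs θ l := by positivity
  have hJ := lintegral_exp_neg_sum_sq_le (μ := μ) s h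
    (fun j ω => predictionGap W θs θ (x (t + (k + j.1)) ω) (u (t + (k + j.1)) ω) j.2) v
    (fun j _ α => by
      have h1 : Measurable fun ω => (x (t + (k + j.1)) ω, u (t + (k + j.1)) ω) :=
        ((hx.measurable_pastAlgebra _).mono (pastAlgebra_le hw hu _) le_rfl).prodMk (hu _)
      have h2 := (measurable_pi_iff.1
        (measurable_predictionGap (W := W) (θs := θs) (θ := θ)) j.2).comp h1
      simp only [Function.comp_def] at h2
      have h3 : Measurable h := hh.mono (pastAlgebra_le hw hu _) le_rfl
      exact (h3.mul (by fun_prop)).aemeasurable)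
    (fun j _ => add_nonneg (stateVar_nonneg hSw hSu _ _ _) (dotProduct_mulVec_self_nonneg hSu _))
    (hkG.trans_le hV)
    (fun j _ α hα => by
      simp_rw [predictionGap_apply]
      exact hdata.lintegral_exp_neg_sq_le hSw hSu hw hu hx t hh (k + j.1) _ _ hα) hβ
  have hsum : ∀ ω, ∑ j ∈ s, predictionGap W θs θ (x (t + (k + j.1)) ω) (u (t + (k + j.1)) ω) j.2 ^ 2
      = ∑ τ ∈ Finset.range k, predictionGap W θs θ (x (t + (k + τ)) ω) (u (t + (k + τ)) ω) ⬝ᵥ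
          predictionGap W θs θ (x (t + (k + τ)) ω) (u (t + (k + τ)) ω) := by
    intro ω
    rw [hs, Finset.sum_product]
    simp only [dotProduct, sq]
  simp_rw [hsum] at hJ
  refine hJ.trans (mul_le_mul_left (ENNReal.ofReal_le_ofReal ?_) _)
  gcongr

/-- The Laplace transform of the squared prediction gaps decays geometrically in the number of
blocks of length `2 k`. -/
lemma IsGaussianExcitation.lintegral_exp_neg_gap_le
    (hdata : IsGaussianExcitation μ Sigw Sigu u w)
    (hSw : Sigw.PosSemidef) (hSu : Sigu.PosSemidef)
    (hw : ∀ t, Measurable (w t)) (hu : ∀ t, Measurable (u t))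
    (hx : IsTrajectory θs x₀ x u w) (W : Matrix (Fin nx) (Fin nx) ℝ) (θ : LTISystem nx nu)
    {k l : ℕ} (hk : 0 < k) (hl : l ≤ k) (hG : 0 < gapVar Sigw Sigu W θs θ l)
    {β : ℝ} (hβ : 0 ≤ β) (J : ℕ) :
    ∫⁻ ω, ENNReal.ofReal (Real.exp (-(β * ∑ j ∈ Finset.range J, ∑ τ ∈ Finset.range k,
        predictionGap W θs θ (x (2 * k * j + (k + τ)) ω) (u (2 * k * j + (k + τ)) ω) ⬝ᵥ
          predictionGap W θs θ (x (2 * k * j + (k + τ)) ω) (u (2 * k * j + (k + τ)) ω)))) ∂μ ≤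
      ENNReal.ofReal (Real.sqrt (1 + 2 * β * (k * gapVar Sigw Sigu W θs θ l)))⁻¹ ^ J := by
  set G : EuclideanSpace ℝ (Fin nx) × EuclideanSpace ℝ (Fin nu) → ℝ := fun q =>
    predictionGap W θs θ q.1 q.2 ⬝ᵥ predictionGap W θs θ q.1 q.2 with hGd
  have hGm : Measurable G := measurable_predictionGap_sq
  set S : ℕ → Ω → ℝ := fun J ω => ∑ j ∈ Finset.range J, ∑ τ ∈ Finset.range k,
    G (x (2 * k * j + (k + τ)) ω, u (2 * k * j + (k + τ)) ω) with hSd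
  have hS : ∀ J, Measurable[pastAlgebra w u (2 * k * J)] (S J) := by
    intro J
    refine Finset.measurable_sum _ fun j hj => Finset.measurable_sum _ fun τ hτ => ?_
    have hlt : 2 * k * j + (k + τ) < 2 * k * J := by
      have h1 : 2 * k * (j + 1) ≤ 2 * k * J := Nat.mul_le_mul_left _ (Finset.mem_range.1 hj)
      have h2 := Finset.mem_range.1 hτ
      rw [mul_add] at h1
      omega
    exact hGm.comp (((hx.measurable_pastAlgebra _).mono (pastAlgebra_mono hlt.le) le_rfl).prodMk
      (measurable_snd.comp (measurable_pair_pastAlgebra hlt)))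
  have hexp : Measurable fun y : ℝ => ENNReal.ofReal (Real.exp (-(β * y))) := by fun_prop
  change ∫⁻ ω, ENNReal.ofReal (Real.exp (-(β * S J ω))) ∂μ ≤ _
  induction J with
  | zero => simp [hSd]
  | succ J ih =>
    have hsplit : ∀ ω, ENNReal.ofReal (Real.exp (-(β * S (J + 1) ω))) =
        ENNReal.ofReal (Real.exp (-(β * S J ω))) * ENNReal.ofReal (Real.exp (-(β *
          ∑ τ ∈ Finset.range k, G (x (2 * k * J + (k + τ)) ω, u (2 * k * J + (k + τ)) ω)))) := by
      intro ω
      rw [← ENNReal.ofReal_mul (Real.exp_pos _).le, ← Real.exp_add, ← neg_add, ← mul_add]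
      simp only [hSd, Finset.sum_range_succ]
    rw [lintegral_congr hsplit, pow_succ']
    -- The exponential of the earlier blocks is known at time 2kJ and serves as the weight `h`.
    exact (hdata.lintegral_exp_neg_gap_block_le hSw hSu hw hu hx W θ hk hl hG (2 * k * J)
      (hexp.comp (hS J)) hβ).trans (mul_le_mul_right ih _)

end Noise

/-! ### From the excitation conditions to the variance of the gap. -/

section Algebra
variable {m n : ℕ}

lemma trace_mul_mul_transpose (M : Matrix (Fin m) (Fin n) ℝ) (S : Matrix (Fin n) (Fin n) ℝ) :
    (M * S * Mᵀ).trace = ∑ r, M r ⬝ᵥ S *ᵥ M r := by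
  refine Finset.sum_congr rfl fun r _ => ?_
  rw [dotProduct_mulVec]
  rfl

lemma dotProduct_mul_mul_transpose_mulVec (a : Fin m → ℝ) (M : Matrix (Fin m) (Fin n) ℝ)
    (S : Matrix (Fin n) (Fin n) ℝ) :
    a ⬝ᵥ (M * S * Mᵀ) *ᵥ a = (a ᵥ* M) ⬝ᵥ S *ᵥ (a ᵥ* M) := by
  rw [← mulVec_mulVec, mulVec_transpose, ← mulVec_mulVec, dotProduct_mulVec]

lemma frobSq_mul (M : Matrix (Fin m) (Fin n) ℝ) {R S : Matrix (Fin n) (Fin n) ℝ}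
    (hR : R * Rᵀ = S) : frobSq (M * R) = ∑ r, M r ⬝ᵥ S *ᵥ M r := by
  rw [← trace_mul_mul_transpose, ← hR, ← Matrix.mul_assoc, Matrix.mul_assoc (M * R), ← transpose_mul]
  refine Finset.sum_congr rfl fun r _ => Finset.sum_congr rfl fun j _ => ?_
  rw [sq]
  rfl

lemma frobSq_sum_le {ι : Type*} (s : Finset ι) (M : ι → Matrix (Fin m) (Fin n) ℝ) :
    frobSq (∑ i ∈ s, M i) ≤ s.card * ∑ i ∈ s, frobSq (M i) := by
  unfold frobSq
  rw [Finset.sum_comm (s := s), Finset.mul_sum]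
  refine Finset.sum_le_sum fun r _ => ?_
  rw [Finset.sum_comm (s := s), Finset.mul_sum]
  refine Finset.sum_le_sum fun c _ => ?_
  rw [Matrix.sum_apply]
  exact sq_sum_le_card_mul_sum_sq

end Algebra

section Excitation
variable {nx nu : ℕ} {Sigw : Matrix (Fin nx) (Fin nx) ℝ} {Sigu : Matrix (Fin nu) (Fin nu) ℝ}

lemma dotProduct_stateGram_mulVec (θ : LTISystem nx nu) (t : ℕ) (a : Fin nx → ℝ) :
    a ⬝ᵥ stateGram Sigw Sigu θ t *ᵥ a = stateVar Sigw Sigu θ (t + 1) a := by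
  simp only [stateGram, stateVar, sum_mulVec, dotProduct_sum, add_mulVec, dotProduct_add,
    dotProduct_mul_mul_transpose_mulVec, vecMul_vecMul]
  exact Finset.sum_congr rfl fun s _ => add_comm _ _

lemma gapVar_nonneg (hw : Sigw.PosSemidef) (hu : Sigu.PosSemidef) (W : Matrix (Fin nx) (Fin nx) ℝ)
    (θs θ : LTISystem nx nu) (t : ℕ) : 0 ≤ gapVar Sigw Sigu W θs θ t :=
  Finset.sum_nonneg fun _ _ =>
    add_nonneg (stateVar_nonneg hw hu _ _ _) (dotProduct_mulVec_self_nonneg hu _)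

/-- The horizon shifts by one because the Gramian at t has t + 1 terms. -/
lemma trace_zCov (W : Matrix (Fin nx) (Fin nx) ℝ) (θs θ : LTISystem nx nu) (t : ℕ) :
    (zCov Sigw Sigu W θs θ t).trace = nx + gapVar Sigw Sigu W θs θ (t + 1) := by
  have h : W * ((θs.B - θ.B) * Sigu * (θs.B - θ.B)ᵀ +
      (θs.A - θ.A) * stateGram Sigw Sigu θs t * (θs.A - θ.A)ᵀ) * Wᵀ =
      (W * (θs.B - θ.B)) * Sigu * (W * (θs.B - θ.B))ᵀ +
      (W * (θs.A - θ.A)) * stateGram Sigw Sigu θs t * (W * (θs.A - θ.A))ᵀ := by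
    simp only [transpose_mul, mul_add, add_mul, Matrix.mul_assoc]
  rw [zCov, h, trace_add, trace_add, trace_mul_mul_transpose, trace_mul_mul_transpose, trace_one,
    Fintype.card_fin, gapVar, Finset.sum_add_distrib]
  simp_rw [dotProduct_stateGram_mulVec]
  ring

/-- Cauchy-Schwarz bounds the square of a sum of t + 1 matrices by t + 1 times the sum of squares.
The loss is harmless, since the energy is summed over k ≥ t + 1 times when t = ⌊k/2⌋. -/
lemma frobExcitation_le (hu : Sigu.PosSemidef)
    (W : Matrix (Fin nx) (Fin nx) ℝ) {Rw : Matrix (Fin nx) (Fin nx) ℝ}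
    {Ru : Matrix (Fin nu) (Fin nu) ℝ} (hRw : Rw * Rwᵀ = Sigw) (hRu : Ru * Ruᵀ = Sigu)
    (θs θ : LTISystem nx nu) (t : ℕ) :
    frobExcitation W Rw Ru θs θ t ≤ nx + (t + 1) * gapVar Sigw Sigu W θs θ (t + 1) := by
  have hU : frobSq (W * dLambdaU Ru θs θ t) ≤ (t + 1) * ∑ s ∈ Finset.range (t + 1), ∑ r,
      ((W * (θs.A - θ.A)) r ᵥ* θs.A ^ s ᵥ* θs.B) ⬝ᵥ Sigu *ᵥ
        ((W * (θs.A - θ.A)) r ᵥ* θs.A ^ s ᵥ* θs.B) := by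
    have h1 : W * dLambdaU Ru θs θ t =
        ∑ s ∈ Finset.range (t + 1), (W * (θs.A - θ.A) * θs.A ^ s * θs.B) * Ru := by
      simp only [dLambdaU, Matrix.mul_sum, Matrix.mul_assoc]
    have h2 := frobSq_sum_le (Finset.range (t + 1))
      fun s => (W * (θs.A - θ.A) * θs.A ^ s * θs.B) * Ru
    simp_rw [frobSq_mul _ hRu, mul_apply_eq_vecMul] at h2
    rw [h1]
    rwa [Finset.card_range, Nat.cast_add_one] at h2
  have hV : frobSq (W * dLambdaW Rw θs θ t) ≤ (t + 1) * ∑ s ∈ Finset.range (t + 1), ∑ r,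
      ((W * (θs.A - θ.A)) r ᵥ* θs.A ^ s) ⬝ᵥ Sigw *ᵥ ((W * (θs.A - θ.A)) r ᵥ* θs.A ^ s) := by
    have h1 : W * dLambdaW Rw θs θ t =
        ∑ s ∈ Finset.range (t + 1), (W * (θs.A - θ.A) * θs.A ^ s) * Rw := by
      simp only [dLambdaW, Matrix.mul_sum, Matrix.mul_assoc]
    have h2 := frobSq_sum_le (Finset.range (t + 1))
      fun s => (W * (θs.A - θ.A) * θs.A ^ s) * Rw
    simp_rw [frobSq_mul _ hRw, mul_apply_eq_vecMul] at h2
    rw [h1]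
    rwa [Finset.card_range, Nat.cast_add_one] at h2
  have hB : frobSq (W * (θs.B - θ.B) * Ru) ≤ (t + 1) *
      ∑ r, (W * (θs.B - θ.B)) r ⬝ᵥ Sigu *ᵥ (W * (θs.B - θ.B)) r := by
    rw [frobSq_mul _ hRu]
    refine le_mul_of_one_le_left
      (Finset.sum_nonneg fun _ _ => dotProduct_mulVec_self_nonneg hu _) ?_
    have : (0 : ℝ) ≤ t := t.cast_nonneg
    linarith
  rw [Finset.sum_comm] at hU hV
  simp only [frobExcitation, gapVar, stateVar, Finset.sum_add_distrib, mul_add] at *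
  linarith

/-- Each of the two excitation conditions forces the variance of the prediction gap to be large. -/
lemma le_mul_gapVar (hw : Sigw.PosSemidef) (hu : Sigu.PosSemidef)
    (W : Matrix (Fin nx) (Fin nx) ℝ) {Rw : Matrix (Fin nx) (Fin nx) ℝ}
    {Ru : Matrix (Fin nu) (Fin nu) ℝ} (hRw : Rw * Rwᵀ = Sigw) (hRu : Ru * Ruᵀ = Sigu)
    (θs θ : LTISystem nx nu) (hnx : 1 ≤ nx) {k T : ℕ} (hk : 1 ≤ k) (hkT : k ≤ T)
    (h : Real.sqrt (nx : ℝ) + (nx : ℝ) ≤ 9 * (k : ℝ) * ((T / k : ℕ) : ℝ) / (3200 * (T : ℝ)) *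
          (zCov Sigw Sigu W θs θ (k / 2)).trace ∨
        Real.sqrt (nx : ℝ) + (nx : ℝ) ≤ 9 * (k : ℝ) * ((T / k : ℕ) : ℝ) / (3200 * (T : ℝ)) *
          frobExcitation W Rw Ru θs θ (k / 2)) :
    354 ≤ k * gapVar Sigw Sigu W θs θ (k / 2 + 1) := by
  set g := gapVar Sigw Sigu W θs θ (k / 2 + 1) with hg
  have hg0 : 0 ≤ g := gapVar_nonneg hw hu W θs θ _
  have hmk : ((k / 2 : ℕ) : ℝ) + 1 ≤ k := by
    have : k / 2 + 1 ≤ k := by omega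
    exact_mod_cast this
  have hk1 : (1 : ℝ) ≤ k := by exact_mod_cast hk
  have hT0 : (0 : ℝ) < T := by exact_mod_cast lt_of_lt_of_le hk hkT
  have hratio : 9 * (k : ℝ) * ((T / k : ℕ) : ℝ) / (3200 * (T : ℝ)) ≤ 9 / 3200 := by
    have h1 : (k : ℝ) * ((T / k : ℕ) : ℝ) ≤ T := by exact_mod_cast Nat.mul_div_le T k
    rw [div_le_div_iff₀ (by positivity) (by norm_num)]
    linarith
  have hratio0 : 0 ≤ 9 * (k : ℝ) * ((T / k : ℕ) : ℝ) / (3200 * (T : ℝ)) := by positivity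
  have hkg : ((k / 2 : ℕ) + 1 : ℝ) * g ≤ k * g := mul_le_mul_of_nonneg_right hmk hg0
  have hnx1 : (1 : ℝ) ≤ nx := by exact_mod_cast hnx
  -- Either excitation is at most nx + k g, and k⌊T/k⌋ ≤ T. With nx ≥ 1 this yields k g ≥ 3200/9 - 1
  -- > 354; the square root is only used as nonnegative.
  have hE : Real.sqrt (nx : ℝ) + (nx : ℝ) ≤ 9 / 3200 * (nx + k * g) := by
    have hpos : 0 ≤ nx + k * g := by positivity
    rcases h with h | h
    · refine h.trans ((mul_le_mul_of_nonneg_left ?_ hratio0).trans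
        (mul_le_mul_of_nonneg_right hratio hpos))
      rw [trace_zCov, ← hg]
      have : g ≤ k * g := le_mul_of_one_le_left hg0 hk1
      linarith
    · refine h.trans ((mul_le_mul_of_nonneg_left ?_ hratio0).trans
        (mul_le_mul_of_nonneg_right hratio hpos))
      have h2 := frobExcitation_le hu W hRw hRu θs θ (k / 2)
      rw [← hg] at h2
      linarith
  have hs := Real.sqrt_nonneg (nx : ℝ)
  linarith

/-- The difference of the costs of a candidate and of the true system. -/
lemma cost_sub_cost {W : Matrix (Fin nx) (Fin nx) ℝ} (hW : Wᵀ * W = Sigw⁻¹)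
    (θs θ : LTISystem nx nu) (x w xnext : EuclideanSpace ℝ (Fin nx)) (u : EuclideanSpace ℝ (Fin nu))
    (h : xnext.ofLp = θs.A *ᵥ x.ofLp + θs.B *ᵥ u.ofLp + w.ofLp) :
    cost Sigw θ xnext x u - cost Sigw θs xnext x u =
      predictionGap W θs θ x u ⬝ᵥ predictionGap W θs θ x u +
        2 * (predictionGap W θs θ x u ⬝ᵥ W *ᵥ w.ofLp) := by
  have hq : ∀ r : Fin nx → ℝ, r ⬝ᵥ Sigw⁻¹ *ᵥ r = (W *ᵥ r) ⬝ᵥ (W *ᵥ r) := fun r => by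
    rw [← hW, ← mulVec_mulVec, dotProduct_mulVec, vecMul_transpose]
  have h1 : xnext.ofLp - θ.A *ᵥ x.ofLp - θ.B *ᵥ u.ofLp =
      ((θs.A - θ.A) *ᵥ x.ofLp + (θs.B - θ.B) *ᵥ u.ofLp) + w.ofLp := by
    rw [h, sub_mulVec, sub_mulVec]
    abel
  have h2 : xnext.ofLp - θs.A *ᵥ x.ofLp - θs.B *ᵥ u.ofLp = w.ofLp := by
    rw [h]
    abel
  simp only [cost]
  rw [h1, h2, hq, hq, mulVec_add]
  change (predictionGap W θs θ x u + W *ᵥ w.ofLp) ⬝ᵥ (predictionGap W θs θ x u + W *ᵥ w.ofLp) -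
    _ = _
  rw [add_dotProduct, dotProduct_add, dotProduct_add,
    dotProduct_comm (W *ᵥ w.ofLp) (predictionGap W θs θ x u)]
  ring

end Excitation

/-! ### Block counting, numerical constants and the Chernoff-type bound. -/

/-- A nonnegative function summed over the second halves of consecutive blocks of length `2 k`. -/
lemma sum_block_le {f : ℕ → ℝ} (hf : ∀ t, 0 ≤ f t) {k J T : ℕ} (hk : 0 < k) (hT : 2 * k * J ≤ T) :
    ∑ j ∈ Finset.range J, ∑ τ ∈ Finset.range k, f (2 * k * j + (k + τ)) ≤
      ∑ t ∈ Finset.Icc 1 T, f t := by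
  -- Time 0 is masked because the empirical risk starts at t = 1; the counted times are all at least
  -- k > 0.
  have hrange : ∀ J, ∑ j ∈ Finset.range J, ∑ τ ∈ Finset.range k, f (2 * k * j + (k + τ)) ≤
      ∑ t ∈ Finset.range (2 * k * J), if t = 0 then 0 else f t := by
    intro J
    induction J with
    | zero => simp
    | succ J ih =>
      rw [Finset.sum_range_succ, mul_add, mul_one, Finset.sum_range_add, two_mul k,
        Finset.sum_range_add (fun i => if (k + k) * J + i = 0 then 0 else f ((k + k) * J + i)) k k]
      have h1 : 0 ≤ ∑ i ∈ Finset.range k,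
          if (k + k) * J + i = 0 then 0 else f ((k + k) * J + i) :=
        Finset.sum_nonneg fun i _ => by split_ifs <;> simp [hf]
      have h2 : ∑ τ ∈ Finset.range k, f ((k + k) * J + (k + τ)) = ∑ i ∈ Finset.range k,
          if (k + k) * J + (k + i) = 0 then 0 else f ((k + k) * J + (k + i)) :=
        Finset.sum_congr rfl fun i _ => by rw [if_neg (by omega)]
      rw [two_mul k] at ih
      linarith
  refine (hrange J).trans ?_
  have hsub : ∑ t ∈ Finset.Icc 1 T, f t = ∑ t ∈ Finset.Icc 1 T, if t = 0 then 0 else f t :=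
    Finset.sum_congr rfl fun t ht => by
      rw [if_neg (Nat.one_le_iff_ne_zero.1 (Finset.mem_Icc.1 ht).1)]
  rw [hsub, ← Finset.sum_filter_ne_zero]
  refine Finset.sum_le_sum_of_subset_of_nonneg (fun t ht => ?_)
    fun t _ _ => by split_ifs <;> simp [hf]
  rw [Finset.mem_filter, Finset.mem_range] at ht
  rw [Finset.mem_Icc]
  have : t ≠ 0 := fun h0 => ht.2 (if_pos h0)
  omega

/-- The burn-in condition leaves enough blocks for the required confidence. -/
lemma exp_neg_two_pow_le {nx N n : ℕ} (hnx : 1 ≤ nx) (hN : 1 ≤ N) {δ : ℝ} (hδ0 : 0 < δ)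
    (hδ1 : δ < 1) (h : (320 / 3 : ℝ) * Real.log (2 * (nx : ℝ) * (N : ℝ) / δ) ≤ (n : ℝ)) :
    Real.exp (-2) ^ (n / 2) ≤ (δ / N) ^ 2 := by
  have hnx1 : (1 : ℝ) ≤ nx := by exact_mod_cast hnx
  have hN1 : (1 : ℝ) ≤ N := by exact_mod_cast hN
  have hNδ : 1 ≤ N / δ := by rw [le_div_iff₀ hδ0]; linarith
  have hℓ : 0 ≤ Real.log (N / δ) := Real.log_nonneg hNδ
  have hlog : Real.log 2 + Real.log (N / δ) ≤ Real.log (2 * (nx : ℝ) * (N : ℝ) / δ) := by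
    rw [← Real.log_mul (by norm_num) (by positivity)]
    refine Real.log_le_log (by positivity) ?_
    rw [mul_div_assoc]
    gcongr
    linarith
  have hn : (n : ℝ) ≤ 2 * (n / 2 : ℕ) + 1 := by
    have : n ≤ 2 * (n / 2) + 1 := by omega
    exact_mod_cast this
  have h2 := Real.log_two_gt_d9
  -- The log 2 inside the condition absorbs the loss from rounding n / 2 down.
  have hJ : Real.log (N / δ) ≤ (n / 2 : ℕ) := by linarith
  have hδN : (δ / N) ^ 2 = Real.exp (-(2 * Real.log (N / δ))) := by
    rw [Real.exp_neg, two_mul, Real.exp_add, Real.exp_log (by positivity), ← sq, ← inv_pow, inv_div]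
  rw [hδN, ← Real.exp_nat_mul]
  exact Real.exp_le_exp.2 (by linarith)

lemma inv_sqrt_le_exp_neg_two {V : ℝ} (hV : 354 ≤ V) :
    (Real.sqrt (1 + 2 * (1 / 8) * V))⁻¹ ≤ Real.exp (-2) := by
  rw [Real.exp_neg]
  refine inv_anti₀ (Real.exp_pos _) (Real.le_sqrt_of_sq_le ?_)
  have h1 : Real.exp 2 = Real.exp 1 ^ 2 := by rw [← Real.exp_nat_mul]; norm_num
  have h2 := Real.exp_one_lt_d9
  -- It suffices that e⁴ ≤ 81 ≤ 1 + 354/4.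
  have h3 : Real.exp 1 ^ 4 ≤ 3 ^ 4 := by
    have := Real.exp_pos 1
    gcongr
    linarith
  rw [h1]
  nlinarith

/-- If `S ≤ m` on an event, then exponential moments of `m` and `-S` bound its probability. -/
lemma measure_le_of_lintegral_exp_le {Ω : Type*} [MeasurableSpace Ω] {μ : Measure Ω}
    {B : Set Ω} {m S : Ω → ℝ} (hmm : Measurable m) (hSm : Measurable S) {c : ℝ} (hc : 0 < c)
    (hm : ∫⁻ ω, ENNReal.ofReal (Real.exp (m ω)) ∂μ ≤ 1)
    (hS : ∫⁻ ω, ENNReal.ofReal (Real.exp (-S ω)) ∂μ ≤ ENNReal.ofReal (c ^ 2))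
    (hB : ∀ ω ∈ B, S ω ≤ m ω) : μ B ≤ ENNReal.ofReal c := by
  have hsub : B ⊆ {ω | 1 ≤ ENNReal.ofReal (c / 2) * ENNReal.ofReal (Real.exp (m ω)) +
        ENNReal.ofReal (1 / (2 * c)) * ENNReal.ofReal (Real.exp (-S ω))} := by
    intro ω hω
    rw [Set.mem_ofPred_eq, ← ENNReal.ofReal_mul (by positivity),
      ← ENNReal.ofReal_mul (by positivity), ← ENNReal.ofReal_add (by positivity) (by positivity),
      ← ENNReal.ofReal_one]
    refine ENNReal.ofReal_le_ofReal ?_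
    have h1 : c / 2 * Real.exp (S ω) ≤ c / 2 * Real.exp (m ω) :=
      mul_le_mul_of_nonneg_left (Real.exp_le_exp.2 (hB ω hω)) (by positivity)
    have hE0 : 0 < Real.exp (S ω) := Real.exp_pos _
    -- AM-GM as a completed square. The weights c/2 and 1/(2c) make both expectations contribute
    -- c/2.
    have h2 : c / 2 * Real.exp (S ω) + 1 / (2 * c) * (Real.exp (S ω))⁻¹ - 1 =
        (c * Real.exp (S ω) - 1) ^ 2 / (2 * c * Real.exp (S ω)) := by
      field_simp
      ring
    have h3 : 0 ≤ (c * Real.exp (S ω) - 1) ^ 2 / (2 * c * Real.exp (S ω)) := by positivity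
    rw [Real.exp_neg]
    linarith
  refine (measure_mono hsub).trans ?_
  have hmarkov := mul_meas_ge_le_lintegral (μ := μ) (f := fun ω =>
    ENNReal.ofReal (c / 2) * ENNReal.ofReal (Real.exp (m ω)) +
      ENNReal.ofReal (1 / (2 * c)) * ENNReal.ofReal (Real.exp (-S ω))) (by fun_prop) 1
  rw [one_mul] at hmarkov
  refine hmarkov.trans ?_
  rw [lintegral_add_left (by fun_prop), lintegral_const_mul' _ _ ENNReal.ofReal_ne_top,
    lintegral_const_mul' _ _ ENNReal.ofReal_ne_top]
  refine (add_le_add (mul_le_mul_right hm _) (mul_le_mul_right hS _)).trans (le_of_eq ?_)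
  rw [mul_one, ← ENNReal.ofReal_mul (by positivity), ← ENNReal.ofReal_add (by positivity)
    (by positivity)]
  congr 1
  field_simp
  ring

/-! ### The error probability of a single candidate. -/

section Error
variable {Ω : Type*} [MeasurableSpace Ω] {μ : Measure Ω} [IsProbabilityMeasure μ]
  {nx nu : ℕ} {Sigw : Matrix (Fin nx) (Fin nx) ℝ} {Sigu : Matrix (Fin nu) (Fin nu) ℝ}
  {u : ℕ → Ω → EuclideanSpace ℝ (Fin nu)} {w : ℕ → Ω → EuclideanSpace ℝ (Fin nx)}
  {θs : LTISystem nx nu} {x₀ : EuclideanSpace ℝ (Fin nx)}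
  {x : ℕ → Ω → EuclideanSpace ℝ (Fin nx)}

lemma IsTrajectory.measurable_state (hx : IsTrajectory θs x₀ x u w)
    (hw : ∀ t, Measurable (w t)) (hu : ∀ t, Measurable (u t)) (t : ℕ) : Measurable (x t) :=
  (hx.measurable_pastAlgebra t).mono (pastAlgebra_le hw hu t) le_rfl

lemma IsTrajectory.measurable_gap_sq (hx : IsTrajectory θs x₀ x u w)
    (hw : ∀ t, Measurable (w t)) (hu : ∀ t, Measurable (u t)) {W : Matrix (Fin nx) (Fin nx) ℝ}
    {θ : LTISystem nx nu} (t : ℕ) : Measurable fun ω =>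
      predictionGap W θs θ (x t ω) (u t ω) ⬝ᵥ predictionGap W θs θ (x t ω) (u t ω) := by
  have h := (measurable_predictionGap_sq (W := W) (θs := θs) (θ := θ)).comp
    ((hx.measurable_state hw hu t).prodMk (hu t))
  simpa only [Function.comp_def] using h

lemma IsTrajectory.measurable_gap_noise (hx : IsTrajectory θs x₀ x u w)
    (hw : ∀ t, Measurable (w t)) (hu : ∀ t, Measurable (u t)) {W : Matrix (Fin nx) (Fin nx) ℝ}
    {θ : LTISystem nx nu} (t : ℕ) : Measurable fun ω =>
      predictionGap W θs θ (x t ω) (u t ω) ⬝ᵥ W *ᵥ (w t ω).ofLp := by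
  have h := (measurable_predictionGap_noise (W := W) (θs := θs) (θ := θ)).comp
    ((hx.measurable_state hw hu t).prodMk ((hw t).prodMk (hu t)))
  simpa only [Function.comp_def] using h

/-- The probability that a candidate is at least as likely as the true system. -/
lemma IsGaussianExcitation.measure_empRisk_le
    (hdata : IsGaussianExcitation μ Sigw Sigu u w) (hSw : Sigw.PosDef) (hSu : Sigu.PosSemidef)
    (hw : ∀ t, Measurable (w t)) (hu : ∀ t, Measurable (u t))
    (hx : IsTrajectory θs x₀ x u w) {W : Matrix (Fin nx) (Fin nx) ℝ} (hW : Wᵀ * W = Sigw⁻¹)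
    (θ : LTISystem nx nu) {k l J T : ℕ} (hk : 0 < k) (hl : l ≤ k) (hT : 2 * k * J ≤ T)
    (hG : 354 ≤ k * gapVar Sigw Sigu W θs θ l) {c : ℝ} (hc : 0 < c)
    (hJ : Real.exp (-2) ^ J ≤ c ^ 2) :
    μ {ω | empRisk Sigw T (fun t => x t ω) (fun t => u t ω) θ ≤
      empRisk Sigw T (fun t => x t ω) (fun t => u t ω) θs} ≤ ENNReal.ofReal c := by
  have hWW : W * Sigw * Wᵀ = 1 := by
    rw [mul_eq_one_comm, ← mul_assoc, hW]
    exact Matrix.nonsing_inv_mul _ ((Matrix.isUnit_iff_isUnit_det _).1 hSw.isUnit)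
  have hG0 : 0 < gapVar Sigw Sigu W θs θ l := by
    by_contra hneg
    have : k * gapVar Sigw Sigu W θs θ l ≤ 0 :=
      mul_nonpos_of_nonneg_of_nonpos k.cast_nonneg (not_lt.1 hneg)
    linarith
  set z : ℕ → Ω → Fin nx → ℝ := fun t ω => predictionGap W θs θ (x t ω) (u t ω) with hz
  set m : Ω → ℝ := fun ω => ∑ t ∈ Finset.Icc 1 T,
    (-(1 / 2) * (z t ω ⬝ᵥ W *ᵥ (w t ω).ofLp) - 1 / 8 * (z t ω ⬝ᵥ z t ω)) with hm
  set S : Ω → ℝ := fun ω => ∑ t ∈ Finset.Icc 1 T, z t ω ⬝ᵥ z t ω with hS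
  have hzz : ∀ t, Measurable fun ω => z t ω ⬝ᵥ z t ω := hx.measurable_gap_sq hw hu
  have hzw : ∀ t, Measurable fun ω => z t ω ⬝ᵥ W *ᵥ (w t ω).ofLp := hx.measurable_gap_noise hw hu
  have hmm : Measurable m := Finset.measurable_sum _ fun t _ =>
    ((hzw t).const_mul _).sub ((hzz t).const_mul _)
  have hSm : Measurable S := Finset.measurable_sum _ fun t _ => hzz t
  have hEm : ∫⁻ ω, ENNReal.ofReal (Real.exp (m ω)) ∂μ ≤ 1 :=
    hdata.lintegral_exp_tilted_le_one hSw.posSemidef hw hu hx hWW θ T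
  have hES : ∫⁻ ω, ENNReal.ofReal (Real.exp (-(1 / 8 * S ω))) ∂μ ≤ ENNReal.ofReal (c ^ 2) := by
    refine le_trans (lintegral_mono fun ω => ?_)
      ((hdata.lintegral_exp_neg_gap_le hSw.posSemidef hSu hw hu hx W θ hk hl hG0
        (β := 1 / 8) (by norm_num) J).trans ?_)
    · have hle : ∑ j ∈ Finset.range J, ∑ τ ∈ Finset.range k,
          z (2 * k * j + (k + τ)) ω ⬝ᵥ z (2 * k * j + (k + τ)) ω ≤ S ω :=
        sum_block_le (f := fun t => z t ω ⬝ᵥ z t ω)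
          (fun t => Finset.sum_nonneg fun _ _ => mul_self_nonneg _) hk hT
      exact ENNReal.ofReal_le_ofReal (Real.exp_le_exp.2 (by linarith))
    · rw [← ENNReal.ofReal_pow (by positivity)]
      refine ENNReal.ofReal_le_ofReal (le_trans ?_ hJ)
      exact pow_le_pow_left₀ (by positivity) (inv_sqrt_le_exp_neg_two hG) J
  refine measure_le_of_lintegral_exp_le hmm (hSm.const_mul (1 / 8)) hc hEm hES fun ω hω => ?_
  rw [Set.mem_ofPred_eq] at hω
  have hcost : ∑ t ∈ Finset.Icc 1 T, (z t ω ⬝ᵥ z t ω + 2 * (z t ω ⬝ᵥ W *ᵥ (w t ω).ofLp)) ≤ 0 := by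
    rcases T.eq_zero_or_pos with h0 | h0
    · simp [h0]
    have hle := le_of_mul_le_mul_left hω (by positivity)
    rw [← sub_nonpos, ← Finset.sum_sub_distrib] at hle
    refine le_trans (le_of_eq (Finset.sum_congr rfl fun t _ => ?_)) hle
    exact (cost_sub_cost hW θs θ _ (w t ω) _ _ (hx.succ_ofLp t ω)).symm
  rw [Finset.sum_add_distrib, ← Finset.mul_sum] at hcost
  -- The cost inequality gives -½ Σ z·W w ≥ ¼ Σ |z|²; subtracting the compensator ⅛ Σ |z|² leaves ⅛
  -- Σ |z|².
  rw [hm, hS]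
  simp only [Finset.sum_sub_distrib, ← Finset.mul_sum]
  linarith

end Error

/-! ### Passage to measurable versions of the data, and the union bound. -/

section Trajectory
variable {Ω : Type*} {nx nu : ℕ}

/-- The trajectory driven by given noise and input sequences. -/
noncomputable def trajectory (θ : LTISystem nx nu) (x₀ : EuclideanSpace ℝ (Fin nx))
    (u : ℕ → Ω → EuclideanSpace ℝ (Fin nu)) (w : ℕ → Ω → EuclideanSpace ℝ (Fin nx)) :
    ℕ → Ω → EuclideanSpace ℝ (Fin nx)
  | 0, _ => x₀
  | t + 1, ω => Matrix.toEuclideanLin θ.A (trajectory θ x₀ u w t ω) +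
      Matrix.toEuclideanLin θ.B (u t ω) + w t ω

lemma isTrajectory_trajectory (θ : LTISystem nx nu) (x₀ : EuclideanSpace ℝ (Fin nx))
    (u : ℕ → Ω → EuclideanSpace ℝ (Fin nu)) (w : ℕ → Ω → EuclideanSpace ℝ (Fin nx)) :
    IsTrajectory θ x₀ (trajectory θ x₀ u w) u w :=
  ⟨fun _ => rfl, fun _ _ => rfl⟩

lemma IsTrajectory.eq_of_eq {θ : LTISystem nx nu} {x₀ : EuclideanSpace ℝ (Fin nx)}
    {x x' : ℕ → Ω → EuclideanSpace ℝ (Fin nx)} {u u' : ℕ → Ω → EuclideanSpace ℝ (Fin nu)}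
    {w w' : ℕ → Ω → EuclideanSpace ℝ (Fin nx)} (hx : IsTrajectory θ x₀ x u w)
    (hx' : IsTrajectory θ x₀ x' u' w') {ω : Ω} (hu : ∀ t, u t ω = u' t ω)
    (hw : ∀ t, w t ω = w' t ω) (t : ℕ) : x t ω = x' t ω := by
  induction t with
  | zero => rw [hx.1, hx'.1]
  | succ t ih => rw [hx.2, hx'.2, ih, hu, hw]

end Trajectory

lemma IsGaussianExcitation.congr {Ω : Type*} [MeasurableSpace Ω] {μ : Measure Ω} {nx nu : ℕ}
    {Sigw : Matrix (Fin nx) (Fin nx) ℝ} {Sigu : Matrix (Fin nu) (Fin nu) ℝ}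
    {u u' : ℕ → Ω → EuclideanSpace ℝ (Fin nu)} {w w' : ℕ → Ω → EuclideanSpace ℝ (Fin nx)}
    (h : IsGaussianExcitation μ Sigw Sigu u w) (hu : ∀ t, u t =ᵐ[μ] u' t)
    (hw : ∀ t, w t =ᵐ[μ] w' t) : IsGaussianExcitation μ Sigw Sigu u' w' where
  indep_time := h.indep_time.congr fun t => by
    filter_upwards [hu t, hw t] with ω h1 h2
    rw [h1, h2]
  indep_noise_input t := (h.indep_noise_input t).congr (hw t) (hu t)
  law_noise t := (h.law_noise t).congr (hw t).symm
  law_input t := (h.law_input t).congr (hu t).symm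

theorem theorem1 {Ω : Type*} [MeasurableSpace Ω] (μ : Measure Ω) [IsProbabilityMeasure μ]
    (nx nu N T : ℕ)
    -- the candidate systems `θ 0, …, θ N`; the true system is `θ 0`
    (θ : Fin (N + 1) → LTISystem nx nu)
    -- the covariances and square-root factors of them and of the inverse of `Sigw`
    (Sigw : Matrix (Fin nx) (Fin nx) ℝ) (Sigu : Matrix (Fin nu) (Fin nu) ℝ)
    (hSigw : Sigw.PosDef) (hSigu : Sigu.PosDef)
    (Rw W : Matrix (Fin nx) (Fin nx) ℝ) (Ru : Matrix (Fin nu) (Fin nu) ℝ)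
    (hRw : Rw * Rwᵀ = Sigw) (hRu : Ru * Ruᵀ = Sigu) (hW : Wᵀ * W = Sigw⁻¹)
    -- the data
    (x₀ : EuclideanSpace ℝ (Fin nx))
    (x w : ℕ → Ω → EuclideanSpace ℝ (Fin nx)) (u : ℕ → Ω → EuclideanSpace ℝ (Fin nu))
    (hdata : IsGaussianExcitation μ Sigw Sigu u w)
    (hx : IsTrajectory (θ 0) x₀ x u w)
    -- the estimator
    (θhat : Ω → LTISystem nx nu)
    (hMLE : ∀ ω, IsMLE Sigw T (fun t => x t ω) (fun t => u t ω) (Set.range θ) (θhat ω))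
    (δ : ℝ) (hδ0 : 0 < δ) (hδ1 : δ < 1)
    -- the burn-in and signal-to-noise conditions
    (hcond : ∃ k : ℕ, 1 ≤ k ∧ k ≤ T ∧
      (320 / 3 : ℝ) * Real.log (2 * (nx : ℝ) * (N : ℝ) / δ) ≤ ((T / k : ℕ) : ℝ) ∧
      ∀ i : Fin (N + 1), i ≠ 0 →
        (Real.sqrt (nx : ℝ) + (nx : ℝ) ≤
            9 * (k : ℝ) * ((T / k : ℕ) : ℝ) / (3200 * (T : ℝ)) *
              (zCov Sigw Sigu W (θ 0) (θ i) (k / 2)).trace ∨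
          Real.sqrt (nx : ℝ) + (nx : ℝ) ≤
            9 * (k : ℝ) * ((T / k : ℕ) : ℝ) / (3200 * (T : ℝ)) *
              frobExcitation W Rw Ru (θ 0) (θ i) (k / 2))) :
    1 - δ ≤ μ.real {ω | θhat ω = θ 0} := by

  obtain ⟨k, hk, hkT, hlog, hsnr⟩ := hcond
  obtain rfl | hnx := Nat.eq_zero_or_pos nx
  -- In state dimension zero all candidates coincide; the bounds below need nx ≥ 1.
  · have : ∀ a b : LTISystem 0 nu, a = b := fun a b =>
      LTISystem.ext (Subsingleton.elim _ _) (Subsingleton.elim _ _)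
    have huniv : {ω | θhat ω = θ 0} = Set.univ := Set.eq_univ_of_forall fun ω => this _ _
    rw [huniv, probReal_univ]
    linarith
  -- The data are only almost everywhere measurable, so the estimates are run on measurable
  -- modifications and on the trajectory these drive.
  set w' : ℕ → Ω → EuclideanSpace ℝ (Fin nx) := fun t => (hdata.law_noise t).aemeasurable.mk _
  set u' : ℕ → Ω → EuclideanSpace ℝ (Fin nu) := fun t => (hdata.law_input t).aemeasurable.mk _
  have hww : ∀ t, w t =ᵐ[μ] w' t := fun t => (hdata.law_noise t).aemeasurable.ae_eq_mk
  have huu : ∀ t, u t =ᵐ[μ] u' t := fun t => (hdata.law_input t).aemeasurable.ae_eq_mk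
  have hwm : ∀ t, Measurable (w' t) := fun t => (hdata.law_noise t).aemeasurable.measurable_mk
  have hum : ∀ t, Measurable (u' t) := fun t => (hdata.law_input t).aemeasurable.measurable_mk
  have hdata' := hdata.congr huu hww
  set x' := trajectory (θ 0) x₀ u' w'
  have hx' : IsTrajectory (θ 0) x₀ x' u' w' := isTrajectory_trajectory _ _ _ _
  set Bad : Fin (N + 1) → Set Ω := fun i =>
    {ω | empRisk Sigw T (fun t => x' t ω) (fun t => u' t ω) (θ i) ≤
      empRisk Sigw T (fun t => x' t ω) (fun t => u' t ω) (θ 0)}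
  have hcover : ∀ᵐ ω ∂μ, ω ∈ {ω | θhat ω = θ 0}ᶜ → ω ∈ ⋃ i ∈ Finset.univ.erase 0, Bad i := by
    filter_upwards [ae_all_iff.2 hww, ae_all_iff.2 huu] with ω h1 h2 hne
    obtain ⟨⟨i, hi⟩, hmin⟩ := hMLE ω
    have hi0 : i ≠ 0 := fun h0 => hne (by rw [Set.mem_ofPred_eq, ← hi, h0])
    refine Set.mem_biUnion (Finset.mem_coe.2 (Finset.mem_erase.2 ⟨hi0, Finset.mem_univ i⟩)) ?_
    have hle := hmin (Set.mem_range_self 0)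
    rw [Set.mem_ofPred_eq, ← hi] at hle
    have hxe : (fun t => x t ω) = fun t => x' t ω := funext (hx.eq_of_eq hx' h2 h1)
    have hue : (fun t => u t ω) = fun t => u' t ω := funext h2
    rw [hxe, hue] at hle
    exact hle
  have hunion : μ {ω | θhat ω = θ 0}ᶜ ≤ ∑ i ∈ Finset.univ.erase 0, μ (Bad i) :=
    (measure_mono_ae hcover).trans (measure_biUnion_finset_le _ _)
  have hbound : μ {ω | θhat ω = θ 0}ᶜ ≤ ENNReal.ofReal δ := by
    obtain rfl | hN := Nat.eq_zero_or_pos N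
    · refine hunion.trans ?_
      rw [show (Finset.univ : Finset (Fin (0 + 1))).erase 0 = ∅ from rfl, Finset.sum_empty]
      exact zero_le
    have hJ := exp_neg_two_pow_le hnx hN hδ0 hδ1 hlog
    have hJT : 2 * k * (T / k / 2) ≤ T := by
      calc 2 * k * (T / k / 2) = k * (2 * (T / k / 2)) := by ring
        _ ≤ k * (T / k) := Nat.mul_le_mul_left _ (Nat.mul_div_le _ _)
        _ ≤ T := Nat.mul_div_le _ _
    have hN0 : (0 : ℝ) < N := by exact_mod_cast hN
    calc μ {ω | θhat ω = θ 0}ᶜ ≤ ∑ i ∈ Finset.univ.erase 0, μ (Bad i) := hunion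
      _ ≤ ∑ _i ∈ (Finset.univ : Finset (Fin (N + 1))).erase 0, ENNReal.ofReal (δ / N) := by
          refine Finset.sum_le_sum fun i hi => ?_
          -- The horizon ⌊k/2⌋ + 1 fits into the k refreshing steps of a block, even for k = 1.
          exact hdata'.measure_empRisk_le hSigw hSigu.posSemidef hwm hum hx' hW (θ i) hk
            (show k / 2 + 1 ≤ k by omega) hJT
            (le_mul_gapVar hSigw.posSemidef hSigu.posSemidef W hRw hRu (θ 0) (θ i) hnx hk hkT
              (hsnr i (Finset.ne_of_mem_erase hi))) (by positivity) hJ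
      _ = ENNReal.ofReal δ := by
          rw [Finset.sum_const, Finset.card_erase_of_mem (Finset.mem_univ _), Finset.card_univ,
            Fintype.card_fin, Nat.add_sub_cancel, nsmul_eq_mul, ← ENNReal.ofReal_natCast,
            ← ENNReal.ofReal_mul hN0.le, mul_div_cancel₀ _ hN0.ne']
  -- The estimator need not be measurable, so only subadditivity is available for the event and its
  -- complement.
  have hone : (1 : ℝ) ≤ μ.real {ω | θhat ω = θ 0} + μ.real {ω | θhat ω = θ 0}ᶜ := by
    rw [← probReal_univ (μ := μ), ← Set.union_compl_self {ω | θhat ω = θ 0}]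
    exact measureReal_union_le _ _
  have hreal : μ.real {ω | θhat ω = θ 0}ᶜ ≤ δ := ENNReal.toReal_le_of_le_ofReal hδ0.le hbound
  linarith
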